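/- Let $T$ be an infinite, locally finite, spherically homogeneous rooted tree (vertices at the same distance from the root, i.e. at the same level, have the same degree), let $\mathrm{Aut}(T)$ be its group of root-fixing automorphisms, and let $\partial T$ be its boundary, i.e. the space of infinite geodesic rays starting at the root, with the topology of pointwise convergence. For a vertex $v$, let $T_v$ be the subtree of vertices $w$ such that the geodesic from the root to $w$ passes through $v$, and let $\partial T_v\subseteq\partial T$ be the set of rays passing through $v$. For $G\le \mathrm{Aut}(T)$ and $U\subseteq\partial T$, let $\mathrm{rist}_G(U)$ be the pointwise fixator in $G$ of $\partial T\setminus U$, and put $\mathrm{rist}_G(v)=\mathrm{rist}_G(\partial T_v)$. Let $G\le\mathrm{Aut}(T)$ be a weakly branch group: $G$ acts transitively on each level of $T$, and $\mathrm{rist}_G(U)\ne 1$ for every non-empty open $U\subseteq\partial T$. Let $\mathrm{Sub}(G)$ be the space of subgroups of $G$ with the topology induced from the product topology on $\{0,1\}^G$, on which $G$ acts by conjugation. Let $\mathcal H\subseteq \mathrm{Sub}(G)$ be a uniformly recurrent subgroup (URS), i.e. a non-empty closed $G$-invariant subset that is minimal with these properties. Let $\mathcal F(\partial T)$ be the space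 of closed subsets of $\partial T$, with the topology generated by the sets $\{C: C\cap K=\varnothing\}$ for $K$ compact and $\{C: C\cap U\neq\varnothing\}$ for $U$ open. For $H\le G$ let $\mathrm{Fix}(H)\in\mathcal F(\partial T)$ be the set of fixed points of $H$ in $\partial T$, and let $F_{\mathcal H}=\{\mathrm{Fix}(H): H\in\mathcal H\}$, with the subspace topology and the natural $G$-action. Let $\Pi(T)$ be the space of sets $\mathcal V$ of vertices of $T$ such that $T_v\cap T_w=\varnothing$ for all distinct $v,w\in \mathcal V$, with the topology induced from the product topology on the power set of the vertex set and the natural $G$-action, and let $\pi_\perp:\Pi(T)\to\mathcal F(\partial T)$, $\pi_\perp(\mathcal V)=\partial T\setminus\bigcup_{v\in\mathcal V}\partial T_v$. Then: 1. The map $\mathcal H\to\mathcal F(\partial T)$, $H\mapsto \mathrm{Fix}(H)$, is continuous. 2. There exists a continuous $G$-equivariant map $\sigma:F_{\mathcal H}\to\Pi(T)$ such that (a) $\pi_\perp(\sigma(C))=C$ for every $C\in F_{\mathcal H}$, and (b) for every $H\in\mathcal H$ and every $v\in\sigma(\mathrm{Fix}(H))$, the derived subgroup $\mathrm{rist}_G(v)'$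 is contained in $H$. -/

import Mathlib

open TopologicalSpace
open scoped Pointwise

universe u

/-! ## The space of subgroups and uniformly recurrent subgroups -/

section Chabauty

variable {G : Type u} [Group G]

/-- The Chabauty topology on the set of subgroups of a (discrete) group: the topology of pointwise
convergence of indicator functions, i.e. the topology induced by the product topology on
`{0,1}^G`. -/
noncomputable instance chabautyTopology : TopologicalSpace (Subgroup G) :=
  open Classical in
  TopologicalSpace.induced (fun (H : Subgroup G) (g : G) => decide (g ∈ H)) inferInstance

/-- A set of subgroups is invariant under conjugation. -/
def ConjInvariant (𝓚 : Set (Subgroup G)) : Prop :=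
  ∀ (g : G), ∀ H ∈ 𝓚, MulAut.conj g • H ∈ 𝓚

/-- A uniformly recurrent subgroup (URS) of `G`: a nonempty closed conjugation-invariant set of
subgroups which is minimal with these properties. -/
structure IsURS (𝓗 : Set (Subgroup G)) : Prop where
  nonempty : 𝓗.Nonempty
  isClosed : IsClosed 𝓗
  invariant : ConjInvariant 𝓗
  minimal : ∀ 𝓚 ⊆ 𝓗, 𝓚.Nonempty → IsClosed 𝓚 → ConjInvariant 𝓚 → 𝓚 = 𝓗

end Chabauty

/-! ## The space of closed subsets -/

/-- The topology on the space of closed subsets of `Y` generated by the sets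
`{C | C ∩ K = ∅}`, `K` compact, and `{C | C ∩ U ≠ ∅}`, `U` open. -/
@[reducible] def closedsTopology (Y : Type u) [TopologicalSpace Y] : TopologicalSpace (Closeds Y) :=
  TopologicalSpace.generateFrom
    ({s | ∃ K : Set Y, IsCompact K ∧ s = {C : Closeds Y | (C : Set Y) ∩ K = ∅}} ∪
     {s | ∃ U : Set Y, IsOpen U ∧ s = {C : Closeds Y | ((C : Set Y) ∩ U).Nonempty}})

/-! ## Micro-supported actions -/

/-- The rigid stabilizer of `U`: the pointwise fixator of the complement of `U`. -/
def rigidStabilizer (G : Type*) {X : Type*} [Group G] [MulAction G X] (U : Set X) : Subgroup G :=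
  fixingSubgroup G Uᶜ

/-- An action is micro-supported if the rigid stabilizers of non-empty open sets are
non-trivial. -/
def MicroSupported (G X : Type*) [Group G] [TopologicalSpace X] [MulAction G X] : Prop :=
  ∀ U : Set X, IsOpen U → U.Nonempty → rigidStabilizer G U ≠ ⊥

/-! ## Rooted trees -/

/-- A locally finite rooted tree with vertex set `V`. -/
structure LFRootedTree (V : Type u) where
  graph : SimpleGraph V
  isTree : graph.IsTree
  root : V
  locallyFinite : ∀ v, (graph.neighborSet v).Finite

namespace LFRootedTree

variable {V : Type u} (T : LFRootedTree V)

/-- The level of a vertex is its distance to the root. -/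
noncomputable def level (v : V) : ℕ := T.graph.dist T.root v

/-- All vertices of the same level have the same degree. -/
def SphericallyHomogeneous : Prop :=
  ∀ v w : V, T.level v = T.level w →
    (T.graph.neighborSet v).ncard = (T.graph.neighborSet w).ncard

/-- `Aut(T)`: the group of automorphisms of the tree that fix the root. -/
def Aut : Subgroup (T.graph ≃g T.graph) where
  carrier := {g | g T.root = T.root}
  one_mem' := rfl
  mul_mem' := by
    intro a b ha hb
    change a (b T.root) = T.root
    rw [show b T.root = T.root from hb, show a T.root = T.root from ha]
  inv_mem' := by
    intro a ha
    change a.symm T.root = T.root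
    rw [RelIso.symm_apply_eq]
    exact (show a T.root = T.root from ha).symm

variable {T} in
theorem smul_adj (g : T.Aut) {v w : V} (h : T.graph.Adj v w) : T.graph.Adj (g • v) (g • w) :=
  g.1.map_adj_iff.2 h

variable {T} in
theorem level_smul (g : T.Aut) (v : V) : T.level (g • v) = T.level v := by
  have key : ∀ (h : T.Aut) (w : V), T.level (h • w) ≤ T.level w := by
    intro h w
    obtain ⟨p, hp⟩ := T.isTree.connected.exists_walk_length_eq_dist T.root w
    have hr : h.1.toHom T.root = T.root := h.2
    have := SimpleGraph.dist_le ((p.map h.1.toHom).copy hr rfl)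
    rw [SimpleGraph.Walk.length_copy, SimpleGraph.Walk.length_map, hp] at this
    exact this
  refine le_antisymm (key g v) ?_
  simpa using key g⁻¹ (g • v)

/-- The set of vertices of the subtree `T_v`: the vertices `w` such that `v` lies on the geodesic
from the root to `w`. -/
def subtree (v : V) : Set V := {w | T.level w = T.level v + T.graph.dist v w}

/-- Two vertices are independent if their subtrees are disjoint. -/
def Independent (v w : V) : Prop := Disjoint (T.subtree v) (T.subtree w)

variable {T} in
theorem smul_mem_subtree (g : T.Aut) {v w : V} (h : w ∈ T.subtree v) :
    g • w ∈ T.subtree (g • v) := by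
  have key : ∀ (h : T.Aut) (x y : V), T.graph.dist (h • x) (h • y) ≤ T.graph.dist x y := by
    intro h x y
    obtain ⟨p, hp⟩ := T.isTree.connected.exists_walk_length_eq_dist x y
    have := SimpleGraph.dist_le (p.map h.1.toHom)
    rw [SimpleGraph.Walk.length_map, hp] at this
    exact this
  have e : T.graph.dist (g • v) (g • w) = T.graph.dist v w :=
    le_antisymm (key g v w) (by simpa using key g⁻¹ (g • v) (g • w))
  change T.level (g • w) = T.level (g • v) + T.graph.dist (g • v) (g • w)
  rw [level_smul, level_smul, e]
  exact h

/-! ### The boundary -/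

/-- The boundary of `T`: the geodesic rays starting at the root. -/
def Boundary : Type u :=
  {ξ : ℕ → V // (∀ n, T.level (ξ n) = n) ∧ ∀ n, T.graph.Adj (ξ n) (ξ (n + 1))}

/-- The topology on the boundary is that of pointwise convergence of rays, where the set of
vertices is discrete. -/
instance : TopologicalSpace T.Boundary :=
  TopologicalSpace.induced Subtype.val (@Pi.topologicalSpace ℕ (fun _ => V) (fun _ => ⊥))

instance : MulAction T.Aut T.Boundary where
  smul g ξ := ⟨fun n => g • ξ.1 n, fun n => (level_smul g _).trans (ξ.2.1 n),
    fun n => smul_adj g (ξ.2.2 n)⟩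
  one_smul _ := rfl
  mul_smul _ _ _ := rfl

instance : ContinuousConstSMul T.Aut T.Boundary where
  continuous_const_smul g := by
    let _ : TopologicalSpace V := ⊥
    have : DiscreteTopology V := ⟨rfl⟩
    refine continuous_induced_rng.2 (continuous_pi fun n => ?_)
    exact (continuous_of_discreteTopology (f := fun v : V => g • v)).comp
      ((continuous_apply n).comp continuous_induced_dom)

instance : T2Space T.Boundary := by
  let _ : TopologicalSpace V := ⊥
  have : DiscreteTopology V := ⟨rfl⟩
  exact inferInstanceAs (T2Space {ξ : ℕ → V //
    (∀ n, T.level (ξ n) = n) ∧ ∀ n, T.graph.Adj (ξ n) (ξ (n + 1))})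

/-- The cylinder `∂T_v`: the rays that pass through `v`. -/
def cylinder (v : V) : Set T.Boundary := {ξ | ξ.1 (T.level v) = v}

theorem isOpen_cylinder (v : V) : IsOpen (T.cylinder v) := by
  let _ : TopologicalSpace V := ⊥
  have : DiscreteTopology V := ⟨rfl⟩
  have h : Continuous fun ξ : T.Boundary => ξ.1 (T.level v) :=
    (continuous_apply (T.level v)).comp continuous_induced_dom
  exact (isOpen_discrete ({v} : Set V)).preimage h

/-- The space of closed subsets of `∂T`. -/
instance : TopologicalSpace (Closeds T.Boundary) := closedsTopology T.Boundary

instance : MulAction T.Aut (Closeds T.Boundary) where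
  smul g C := ⟨g • (C : Set T.Boundary), C.isClosed.smul g⟩
  one_smul C := Closeds.ext (one_smul T.Aut (C : Set T.Boundary))
  mul_smul g h C := Closeds.ext (mul_smul g h (C : Set T.Boundary))

/-! ### Sets of pairwise independent vertices -/

/-- `Π(T)`: the sets of pairwise independent vertices. -/
def Antichain : Type u := {𝓥 : Set V // 𝓥.Pairwise T.Independent}

/-- The topology on `Π(T)` is induced by the product topology on the power set `{0,1}^V`. -/
noncomputable instance : TopologicalSpace T.Antichain :=
  open Classical in
  TopologicalSpace.induced (fun (𝓥 : T.Antichain) (v : V) => decide (v ∈ 𝓥.1)) inferInstance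

instance : MulAction T.Aut T.Antichain where
  smul g 𝓥 := ⟨g • 𝓥.1, by
    rintro _ ⟨v, hv, rfl⟩ _ ⟨w, hw, rfl⟩ hne
    have hvw : v ≠ w := fun h => hne (congrArg (fun x => g • x) h)
    refine Set.disjoint_left.2 fun x hx hx' => ?_
    have h1 := smul_mem_subtree g⁻¹ hx
    have h2 := smul_mem_subtree g⁻¹ hx'
    simp only [inv_smul_smul] at h1 h2
    exact Set.disjoint_left.1 (𝓥.2 hv hw hvw) h1 h2⟩
  one_smul 𝓥 := Subtype.ext (one_smul T.Aut 𝓥.1)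
  mul_smul g h 𝓥 := Subtype.ext (mul_smul g h 𝓥.1)

/-- The map `π_⊥ : Π(T) → F(∂T)` sending `𝓥` to the complement of the union of the cylinders
`∂T_v`, `v ∈ 𝓥`. -/
def piPerp (𝓥 : T.Antichain) : Closeds T.Boundary :=
  ⟨(⋃ v ∈ 𝓥.1, T.cylinder v)ᶜ,
    (isOpen_biUnion fun v _ => T.isOpen_cylinder v).isClosed_compl⟩

/-! ### Groups of tree automorphisms -/

variable {T} (G : Subgroup T.Aut)

/-- A subgroup of `Aut(T)` is level-transitive if it acts transitively on each level. -/
def LevelTransitive : Prop :=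
  ∀ v w : V, T.level v = T.level w → ∃ g : G, g • v = w

/-- A weakly branch group: a level-transitive subgroup of the automorphism group of an infinite
spherically homogeneous rooted tree whose action on the boundary is micro-supported. -/
structure IsWeaklyBranch : Prop where
  infinite : Infinite V
  sphericallyHomogeneous : T.SphericallyHomogeneous
  levelTransitive : LevelTransitive G
  microSupported : MicroSupported G T.Boundary

/-- The rigid stabilizer in `G` of a vertex `v`. -/
def rist (v : V) : Subgroup G := rigidStabilizer G (T.cylinder v)

variable {G}

/-- The closed set of fixed points in `∂T` of a subgroup `H` of `G`. -/
def fixedSet (H : Subgroup G) : Closeds T.Boundary :=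
  ⟨{ξ | ∀ h ∈ H, h • ξ = ξ}, by
    simp only [Set.ofPred_forall]
    exact isClosed_biInter fun h _ => isClosed_eq (continuous_const_smul (h : T.Aut)) continuous_id⟩

/-- `F_𝓗 = {Fix(H) : H ∈ 𝓗}`, a subspace of the space of closed subsets of `∂T`. -/
def fixedSets (𝓗 : Set (Subgroup G)) : Set (Closeds T.Boundary) := fixedSet '' 𝓗

end LFRootedTree

/-!
The proof rests on a local commutator lemma for confined subgroups, combined with the minimality of
the URS. Write `X` for the boundary `∂T` and `rist(U)'` for the derived subgroup of a rigid
stabilizer.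

*The local commutator lemma.* In a weakly branch group, `rist(U)` moves every point of `U`, because
its fixed points in a cylinder are invariant under the stabilizer of a vertex, which acts on that
cylinder with dense orbits (`IsWeaklyBranch.movesEveryPoint`). Hence finite-index subgroups of
`rist(U)` have infinite orbits in `U`. Suppose that all elements of a finite set `P` move `U` off
itself and that each `rist(U)`-conjugate of `H` meets `P`. Colour `y ∈ rist(U)` by some `p ∈ P` with
`y p y⁻¹ ∈ H`. If `y` and `z` have the same colour, then the element of `H` given by the quotient of
`y p y⁻¹` by `z p z⁻¹` acts on `U` as `y z⁻¹` and outside of `U` in a way that depends on `y⁻¹ z`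
only. The first fact shows that a finite-index subgroup of `rist(U)` normalizes `H ∩ rist(U)`; the
second one and the pigeonhole principle show that `H ∩ rist(U)` moves any prescribed point `x ∈ U`.
The classical double commutator trick now gives `rist(W)' ≤ H` for a neighbourhood `W` of `x`
(`MovesEveryPoint.exists_commutator_le_of_confined`).

*Fixed points.* Let `H` belong to the URS `𝓗` and let `h ∈ H` move `x`, hence some vertex `v` on the
ray `x`. The point `H` is uniformly recurrent not only for `G` but also for the pointwise stabilizer
`N` of the level of `v` (`IsURS.mem_conjClosure_of_mem`), so compactness gives a finite set `P` of
`N`-conjugates of `h` that meets all `N`-conjugates of `H`. All elements of `P` move `v` in the same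
way as `h`, and the local lemma applies in `∂T_v`. Therefore `x` is not fixed by `H` if and only if
`rist(w)' ≤ H` for some vertex `w` on `x`.

*Continuity.* The set of vertices `v` of level `n` such that `rist(w)' ≤ H` for all descendants `w`
of `v` of level `m` depends upper semicontinuously and equivariantly on `H`. By minimality its
cardinality is constant on `𝓗` (`IsURS.ncard_eq`), so it is a locally constant function of `H`.
These sets increase with `m`, so by constancy of cardinalities they become stationary at some
`m = m(n)` that works for all `H ∈ 𝓗` (`IsWeaklyBranch.exists_uniform_depth`); the limit consists of
the vertices `v` of level `n` with `∂T_v ∩ Fix(H) = ∅`. Thus disjointness of `∂T_v` and `Fix(H)` is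
a clopen condition on `H`, which is continuity of `H ↦ Fix(H)`. The map `σ` sends `C` to the set of
descendants of level `m(n)` of those vertices, `n` being their level, that are topmost among the
vertices `v` with `∂T_v ∩ C = ∅` (`LFRootedTree.topAntichain`). The topmost vertices themselves
would not do: the derived rigid stabilizer of a vertex need not be contained in `H` when those of
all its children are.
-/

open scoped commutatorElement

/-! ### Rigid stabilizers and finite-index subgroups -/

section RigidStabilizer

variable {G X : Type*} [Group G] [MulAction G X]

theorem mem_rigidStabilizer {U : Set X} {g : G} :
    g ∈ rigidStabilizer G U ↔ ∀ x ∉ U, g • x = x :=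
  mem_fixingSubgroup_iff G

theorem rigidStabilizer_mono {U W : Set X} (h : U ⊆ W) :
    rigidStabilizer G U ≤ rigidStabilizer G W := fun _ hg =>
  mem_rigidStabilizer.2 fun x hx => mem_rigidStabilizer.1 hg x fun hU => hx (h hU)

theorem smul_mem_of_mem_rigidStabilizer {U : Set X} {g : G} (hg : g ∈ rigidStabilizer G U)
    {x : X} (hx : x ∈ U) : g • x ∈ U := by
  by_contra h
  have h1 := mem_rigidStabilizer.1 hg _ h
  exact h ((smul_left_cancel g h1).symm ▸ hx)

theorem conj_mem_rigidStabilizer {U : Set X} {g : G} (hg : g ∈ rigidStabilizer G U) (a : G) :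
    a * g * a⁻¹ ∈ rigidStabilizer G (a • U) := by
  refine mem_rigidStabilizer.2 fun x hx => ?_
  have h := mem_rigidStabilizer.1 hg (a⁻¹ • x) fun h => hx (Set.mem_smul_set_iff_inv_smul_mem.2 h)
  rw [mul_smul, mul_smul, h, smul_inv_smul]

/-- The action has to be faithful: elements with disjoint supports commute on `X` only. -/
theorem commute_of_mem_rigidStabilizer [FaithfulSMul G X] {U W : Set X} (hUW : Disjoint U W)
    {g h : G} (hg : g ∈ rigidStabilizer G U) (hh : h ∈ rigidStabilizer G W) : Commute g h := by
  refine FaithfulSMul.eq_of_smul_eq_smul (α := X) fun x => ?_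
  rw [mul_smul, mul_smul]
  by_cases hx : x ∈ U
  · rw [mem_rigidStabilizer.1 hh x (Set.disjoint_left.1 hUW hx), mem_rigidStabilizer.1 hh _
      (Set.disjoint_left.1 hUW (smul_mem_of_mem_rigidStabilizer hg hx))]
  · rw [mem_rigidStabilizer.1 hg x hx]
    by_cases hx' : x ∈ W
    · exact mem_rigidStabilizer.1 hg _
        (Set.disjoint_right.1 hUW (smul_mem_of_mem_rigidStabilizer hh hx'))
    · rw [mem_rigidStabilizer.1 hh x hx', mem_rigidStabilizer.1 hg x hx]

/-- The double commutator trick: `⁅y, n⁆` is `y` times an element supported in the translate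
`n • W`, and the latter does not see `z`. -/
theorem commutator_commutator_eq [FaithfulSMul G X] {W : Set X} {n : G} (hn : Disjoint (n • W) W)
    {y z : G} (hy : y ∈ rigidStabilizer G W) (hz : z ∈ rigidStabilizer G W) :
    ⁅⁅y, n⁆, z⁆ = ⁅y, z⁆ := by
  have hc : n * y⁻¹ * n⁻¹ ∈ rigidStabilizer G (n • W) :=
    conj_mem_rigidStabilizer (inv_mem hy) n
  have h1 : Commute (n * y⁻¹ * n⁻¹) z := commute_of_mem_rigidStabilizer hn hc hz
  have h2 : ⁅y, n⁆ = y * (n * y⁻¹ * n⁻¹) := by rw [commutatorElement_def]; group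
  rw [h2]
  generalize n * y⁻¹ * n⁻¹ = c at h1
  rw [commutatorElement_def, commutatorElement_def]
  calc y * c * z * (y * c)⁻¹ * z⁻¹ = y * (c * z) * c⁻¹ * y⁻¹ * z⁻¹ := by group
    _ = y * z * y⁻¹ * z⁻¹ := by rw [h1.eq]; group

/-- `⁅a, g⁆` agrees with `a` on `W`, because `g * a⁻¹ * g⁻¹` is supported in `g • W`. -/
theorem commutator_smul_ne {W : Set X} {a g : G} (hg : Disjoint (g • W) W)
    (ha : a ∈ rigidStabilizer G W) {x : X} (hx : x ∈ W) (hax : a • x ≠ x) : ⁅a, g⁆ • x ≠ x := by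
  have h1 := mem_rigidStabilizer.1 (conj_mem_rigidStabilizer (inv_mem ha) g) x
    (Set.disjoint_right.1 hg hx)
  have h2 : ⁅a, g⁆ = a * (g * a⁻¹ * g⁻¹) := by rw [commutatorElement_def]; group
  rw [h2, mul_smul, h1]
  exact hax

theorem commutator_rigidStabilizer_le [FaithfulSMul G X] {W : Set X} {n : G}
    (hn : Disjoint (n • W) W) {M : Subgroup G} (hnM : n ∈ M)
    (hM : ∀ g ∈ rigidStabilizer G W, ∀ m ∈ M, g * m * g⁻¹ ∈ M) :
    ⁅rigidStabilizer G W, rigidStabilizer G W⁆ ≤ M := by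
  refine Subgroup.commutator_le.2 fun y hy z hz => ?_
  rw [← commutator_commutator_eq hn hy hz]
  have h1 : ⁅y, n⁆ ∈ M := by
    rw [commutatorElement_def]
    exact mul_mem (hM y hy n hnM) (inv_mem hnM)
  rw [commutatorElement_def ⁅y, n⁆ z, mul_assoc, mul_assoc, ← mul_assoc z]
  exact mul_mem h1 (hM z hz _ (inv_mem h1))

theorem relIndex_rigidStabilizer_ne_zero_of_subset {K : Subgroup G} {U W : Set X} (hWU : W ⊆ U)
    (hK : K.relIndex (rigidStabilizer G U) ≠ 0) : K.relIndex (rigidStabilizer G W) ≠ 0 := fun h0 =>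
  hK (Subgroup.relIndex_eq_zero_of_le_right (rigidStabilizer_mono hWU) h0)

/-- The elements of `rigidStabilizer G U` that extend, by an element supported in the complement
of `U`, to an element of `H`. -/
def extendable [FaithfulSMul G X] (H : Subgroup G) (U : Set X) : Subgroup G where
  carrier := {a | a ∈ rigidStabilizer G U ∧ ∃ c ∈ rigidStabilizer G Uᶜ, a * c ∈ H}
  one_mem' := ⟨one_mem _, 1, one_mem _, by simp⟩
  mul_mem' := by
    rintro a b ⟨ha, c, hc, hac⟩ ⟨hb, d, hd, hbd⟩
    refine ⟨mul_mem ha hb, c * d, mul_mem hc hd, ?_⟩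
    have h1 : Commute b c := commute_of_mem_rigidStabilizer disjoint_compl_right hb hc
    have h2 : a * b * (c * d) = a * c * (b * d) := by
      rw [mul_assoc, ← mul_assoc b, h1.eq]; group
    exact h2 ▸ mul_mem hac hbd
  inv_mem' := by
    rintro a ⟨ha, c, hc, hac⟩
    refine ⟨inv_mem ha, c⁻¹, inv_mem hc, ?_⟩
    have h1 : Commute a c := commute_of_mem_rigidStabilizer disjoint_compl_right ha hc
    rw [← mul_inv_rev, ← h1.eq]
    exact inv_mem hac

theorem conj_extendable [FaithfulSMul G X] {H : Subgroup G} {U : Set X} {a m : G}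
    (ha : a ∈ extendable H U) (hm : m ∈ H ⊓ rigidStabilizer G U) :
    a * m * a⁻¹ ∈ H ⊓ rigidStabilizer G U := by
  obtain ⟨haU, c, hc, hac⟩ := ha
  have h1 : Commute m c := commute_of_mem_rigidStabilizer disjoint_compl_right hm.2 hc
  refine ⟨?_, mul_mem (mul_mem haU hm.2) (Subgroup.inv_mem _ haU)⟩
  have h2 : a * m * a⁻¹ = a * c * m * (a * c)⁻¹ := by
    calc a * m * a⁻¹ = a * (m * c) * c⁻¹ * a⁻¹ := by group
      _ = a * c * m * (a * c)⁻¹ := by rw [h1.eq]; group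
  rw [h2]
  exact mul_mem (mul_mem hac hm.1) (Subgroup.inv_mem _ hac)

/-- If `H` contains the conjugates of `p` by `y` and by `z`, then it contains their quotient, which
acts on `U` as `y * z⁻¹`. -/
theorem mul_inv_mul_conj_mem [FaithfulSMul G X] {H : Subgroup G} {U : Set X} {p y z : G}
    (hp : Disjoint (p • U) U)
    (hy : y ∈ rigidStabilizer G U) (hz : z ∈ rigidStabilizer G U)
    (hyH : y * p * y⁻¹ ∈ H) (hzH : z * p * z⁻¹ ∈ H) :
    y * z⁻¹ * (p * (y⁻¹ * z) * p⁻¹) ∈ H ∧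
      p * (y⁻¹ * z) * p⁻¹ ∈ rigidStabilizer G Uᶜ := by
  have h1 : p * (y⁻¹ * z) * p⁻¹ ∈ rigidStabilizer G (p • U) :=
    conj_mem_rigidStabilizer (mul_mem (inv_mem hy) hz) p
  have h2 := commute_of_mem_rigidStabilizer hp h1 (inv_mem hz)
  refine ⟨?_, rigidStabilizer_mono (Set.subset_compl_iff_disjoint_right.2 hp) h1⟩
  have h3 : y * z⁻¹ * (p * (y⁻¹ * z) * p⁻¹) = y * p * y⁻¹ * (z * p * z⁻¹)⁻¹ := by
    rw [mul_assoc, ← h2.eq]; group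
  rw [h3]
  exact mul_mem hyH (inv_mem hzH)

/-- Elements `y` and `z` of `rigidStabilizer G U` that conjugate the same `p ∈ P` into `H` lie in the
same coset of `extendable H U`, so there are at most as many cosets as elements of `P`. -/
theorem relIndex_extendable_ne_zero [FaithfulSMul G X] {H : Subgroup G} {U : Set X} {P : Finset G}
    (hP : ∀ p ∈ P, Disjoint (p • U) U)
    (hH : ∀ g ∈ rigidStabilizer G U, ∃ p ∈ P, g * p * g⁻¹ ∈ H) :
    (extendable H U).relIndex (rigidStabilizer G U) ≠ 0 := by
  set L := rigidStabilizer G U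
  choose col hcol hcolH using fun g : L => hH g g.2
  let f : L ⧸ (extendable H U).subgroupOf L → P := fun q => ⟨col q.out⁻¹, hcol _⟩
  have hf : Function.Injective f := by
    intro q q' hqq
    have h1 : col q.out⁻¹ = col q'.out⁻¹ := congrArg Subtype.val hqq
    rw [← q.out_eq', ← q'.out_eq']
    refine QuotientGroup.eq.2 ?_
    have h2 := mul_inv_mul_conj_mem (hP _ (hcol q.out⁻¹)) (q.out⁻¹ : L).2 (q'.out⁻¹ : L).2
      (hcolH q.out⁻¹) (h1 ▸ hcolH q'.out⁻¹)
    refine ⟨(q.out⁻¹ * q'.out).2, _, h2.2, ?_⟩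
    simpa using h2.1
  have : Finite (L ⧸ (extendable H U).subgroupOf L) := Finite.of_injective f hf
  exact Subgroup.index_ne_zero_of_finite

end RigidStabilizer

/-- Every point of every open set `U` is moved by the rigid stabilizer of `U`. -/
def MovesEveryPoint (G X : Type*) [Group G] [TopologicalSpace X] [MulAction G X] : Prop :=
  ∀ U : Set X, IsOpen U → ∀ x ∈ U, ∃ g ∈ rigidStabilizer G U, g • x ≠ x

section MovesEveryPoint

variable {G X : Type*} [Group G] [TopologicalSpace X] [T2Space X] [MulAction G X]

theorem exists_open_disjoint_smul [ContinuousConstSMul G X] {g : G} {x : X} (h : g • x ≠ x)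
    {U : Set X} (hU : IsOpen U) (hx : x ∈ U) :
    ∃ W, IsOpen W ∧ x ∈ W ∧ W ⊆ U ∧ Disjoint (g • W) W := by
  obtain ⟨A, B, hA, hB, hxA, hxB, hAB⟩ := t2_separation h
  refine ⟨U ∩ B ∩ (fun y => g • y) ⁻¹' A, (hU.inter hB).inter (hA.preimage
    (continuous_const_smul g)), ⟨⟨hx, hxB⟩, hxA⟩, fun y hy => hy.1.1, ?_⟩
  refine Set.disjoint_left.2 ?_
  rintro _ ⟨y, hy, rfl⟩ hy'
  exact Set.disjoint_left.1 hAB hy.2 hy'.1.2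

/-- If arbitrarily small rigid stabilizers, intersected with `K`, move `x`, then each of these
moves `x` to infinitely many points: a small neighbourhood of `x` avoids the remainder of a finite
orbit. -/
theorem infinite_orbit_of_moves {K : Subgroup G} {U : Set X} {x : X} (hU : IsOpen U) (hx : x ∈ U)
    (hK : ∀ W : Set X, IsOpen W → x ∈ W → W ⊆ U →
      ∃ k ∈ K, k ∈ rigidStabilizer G W ∧ k • x ≠ x) :
    {y : X | ∃ k ∈ K, k ∈ rigidStabilizer G U ∧ k • x = y}.Infinite := by
  intro hfin
  set O := {y : X | ∃ k ∈ K, k ∈ rigidStabilizer G U ∧ k • x = y}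
  have hcl : IsClosed (O \ {x}) := (hfin.subset Set.sdiff_subset).isClosed
  obtain ⟨k, hk, hkW, hkx⟩ := hK (U ∩ (O \ {x})ᶜ) (hU.inter hcl.isOpen_compl)
    ⟨hx, fun h => h.2 rfl⟩ Set.inter_subset_left
  have h1 := smul_mem_of_mem_rigidStabilizer hkW
    (show x ∈ U ∩ (O \ {x})ᶜ from ⟨hx, fun h => h.2 rfl⟩)
  exact h1.2 ⟨⟨k, hk, rigidStabilizer_mono Set.inter_subset_left hkW, rfl⟩, hkx⟩

theorem MovesEveryPoint.exists_of_relIndex (h : MovesEveryPoint G X) {K : Subgroup G} {U : Set X}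
    (hU : IsOpen U) (hK : K.relIndex (rigidStabilizer G U) ≠ 0) {x : X} (hx : x ∈ U) :
    ∃ k ∈ K, k ∈ rigidStabilizer G U ∧ k • x ≠ x := by
  by_contra! hcon
  have hinf := infinite_orbit_of_moves (K := ⊤) hU hx fun W hW hxW _ => by
    obtain ⟨g, hg, hgx⟩ := h W hW x hxW
    exact ⟨g, Subgroup.mem_top g, hg, hgx⟩
  have hle : K.subgroupOf (rigidStabilizer G U) ≤
      MulAction.stabilizer (rigidStabilizer G U) x := fun k hk => hcon k hk k.2
  have hidx : (MulAction.stabilizer (rigidStabilizer G U) x).index ≠ 0 := fun h0 =>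
    hK (Nat.eq_zero_of_zero_dvd (h0 ▸ Subgroup.index_dvd_of_le hle))
  rw [MulAction.index_stabilizer] at hidx
  refine hinf ((Set.finite_of_ncard_ne_zero hidx).subset ?_)
  rintro _ ⟨k, -, hk, rfl⟩
  exact ⟨⟨k, hk⟩, rfl⟩

theorem MovesEveryPoint.infinite_orbit (h : MovesEveryPoint G X) {K : Subgroup G} {U : Set X}
    (hU : IsOpen U) (hK : K.relIndex (rigidStabilizer G U) ≠ 0) {x : X} (hx : x ∈ U) :
    {y : X | ∃ k ∈ K, k ∈ rigidStabilizer G U ∧ k • x = y}.Infinite :=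
  infinite_orbit_of_moves hU hx fun _ hW hxW hWU =>
    h.exists_of_relIndex hW (relIndex_rigidStabilizer_ne_zero_of_subset hWU hK) hxW

/-- A sequence of elements of `K` that move `x` to pairwise distinct points. -/
theorem MovesEveryPoint.exists_seq (h : MovesEveryPoint G X) {K : Subgroup G} {U : Set X}
    (hU : IsOpen U) (hK : K.relIndex (rigidStabilizer G U) ≠ 0) {x : X} (hx : x ∈ U) :
    ∃ k : ℕ → G, (∀ i, k i ∈ K) ∧ (∀ i, k i ∈ rigidStabilizer G U) ∧
      Function.Injective fun i => k i • x := by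
  have hinf := h.infinite_orbit hU hK hx
  let e := hinf.natEmbedding
  choose k hk hkU hkx using fun i => (e i).2
  refine ⟨k, hk, hkU, fun i j hij => e.injective (Subtype.ext ?_)⟩
  rw [← hkx i, ← hkx j]
  exact hij

/-- A subgroup normalized by a finite-index subgroup of `rigidStabilizer G U` that moves `x`
contains the derived subgroup of the rigid stabilizer of a neighbourhood of `x`. The double
commutator trick is used twice: a first time it gives the derived subgroup of a finite-index
subgroup, a second time it removes the finite index. -/
theorem MovesEveryPoint.exists_commutator_le [FaithfulSMul G X] [ContinuousConstSMul G X]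
    (h : MovesEveryPoint G X) {A M : Subgroup G} {U : Set X} (hU : IsOpen U)
    (hA : A.relIndex (rigidStabilizer G U) ≠ 0) (hAM : ∀ a ∈ A, ∀ m ∈ M, a * m * a⁻¹ ∈ M)
    {x : X} (hx : x ∈ U) {m : G} (hm : m ∈ M) (hmx : m • x ≠ x) :
    ∃ W, IsOpen W ∧ x ∈ W ∧ ⁅rigidStabilizer G W, rigidStabilizer G W⁆ ≤ M := by
  obtain ⟨W₁, hW₁, hxW₁, hW₁U, hmW₁⟩ := exists_open_disjoint_smul hmx hU hx
  set L := rigidStabilizer G W₁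
  have hAL : A.relIndex L ≠ 0 := relIndex_rigidStabilizer_ne_zero_of_subset hW₁U hA
  have : (A.subgroupOf L).FiniteIndex := ⟨hAL⟩
  let K : Subgroup G := (A.subgroupOf L).normalCore.map L.subtype
  have hKL : K ≤ L := Subgroup.map_subtype_le _
  have hKA : K ≤ A := by
    rintro _ ⟨k, hk, rfl⟩
    exact (A.subgroupOf L).normalCore_le hk
  have hKfin : K.relIndex L ≠ 0 := by
    have h1 : K.subgroupOf L = (A.subgroupOf L).normalCore :=
      Subgroup.comap_map_eq_self_of_injective L.subtype_injective _
    rw [Subgroup.relIndex, h1]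
    exact Subgroup.FiniteIndex.index_ne_zero
  have hKconj : ∀ l ∈ L, ∀ k ∈ K, l * k * l⁻¹ ∈ K := by
    rintro l hl _ ⟨k, hk, rfl⟩
    exact ⟨⟨l, hl⟩ * k * ⟨l, hl⟩⁻¹, (Subgroup.normalCore_normal _).conj_mem k hk ⟨l, hl⟩, rfl⟩
  have hKM : ⁅K, K⁆ ≤ M := by
    refine Subgroup.commutator_le.2 fun y hy z hz => ?_
    rw [← commutator_commutator_eq hmW₁ (hKL hy) (hKL hz)]
    have h1 : ⁅y, m⁆ ∈ M := by
      rw [commutatorElement_def]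
      exact mul_mem (hAM y (hKA hy) m hm) (inv_mem hm)
    rw [commutatorElement_def ⁅y, m⁆ z, mul_assoc, mul_assoc, ← mul_assoc z]
    exact mul_mem h1 (hAM z (hKA hz) _ (inv_mem h1))
  obtain ⟨g, hg, -, hgx⟩ := h.exists_of_relIndex hW₁ hKfin hxW₁
  obtain ⟨W₂, hW₂, hxW₂, hW₂₁, hgW₂⟩ := exists_open_disjoint_smul hgx hW₁ hxW₁
  obtain ⟨a, ha, haW₂, hax⟩ := h.exists_of_relIndex hW₂
    (relIndex_rigidStabilizer_ne_zero_of_subset hW₂₁ hKfin) hxW₂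
  have hnx : ⁅a, g⁆ • x ≠ x := commutator_smul_ne hgW₂ haW₂ hxW₂ hax
  obtain ⟨W₃, hW₃, hxW₃, hW₃₂, hnW₃⟩ := exists_open_disjoint_smul hnx hW₂ hxW₂
  refine ⟨W₃, hW₃, hxW₃, (commutator_rigidStabilizer_le hnW₃
    (Subgroup.commutator_mem_commutator ha hg) fun l hl k hk => ?_).trans hKM⟩
  have hlL : l ∈ L := rigidStabilizer_mono (hW₃₂.trans hW₂₁) hl
  have hmap : (⁅K, K⁆ : Subgroup G).map (MulAut.conj l).toMonoidHom ≤ ⁅K, K⁆ := by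
    rw [Subgroup.map_commutator]
    have : K.map (MulAut.conj l).toMonoidHom ≤ K := by
      rintro _ ⟨k, hk, rfl⟩
      exact hKconj l hlL k hk
    exact Subgroup.commutator_mono this this
  exact hmap ⟨k, hk, rfl⟩

/-- The local form of the commutator lemma for confined subgroups. Suppose that every conjugate of
`H` by an element of `rigidStabilizer G U` meets the finite set `P`, all of whose elements move `U`
off itself. Then `H` contains the derived subgroup of the rigid stabilizer of a neighbourhood of
each point of `U`. -/
theorem MovesEveryPoint.exists_commutator_le_of_confined [FaithfulSMul G X]
    [ContinuousConstSMul G X] (h : MovesEveryPoint G X) {H : Subgroup G} {U : Set X}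
    (hU : IsOpen U) {P : Finset G} (hP : ∀ p ∈ P, Disjoint (p • U) U)
    (hH : ∀ g ∈ rigidStabilizer G U, ∃ p ∈ P, g * p * g⁻¹ ∈ H) {x : X} (hx : x ∈ U) :
    ∃ W, IsOpen W ∧ x ∈ W ∧ ⁅rigidStabilizer G W, rigidStabilizer G W⁆ ≤ H := by
  have hA := relIndex_extendable_ne_zero hP hH
  set A := extendable H U
  suffices hM : ∃ m ∈ H ⊓ rigidStabilizer G U, m • x ≠ x by
    obtain ⟨m, hm, hmx⟩ := hM
    obtain ⟨W, hW, hxW, hle⟩ := h.exists_commutator_le hU hA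
      (fun a ha m hm => conj_extendable ha hm) hx hm hmx
    exact ⟨W, hW, hxW, hle.trans inf_le_left⟩
  -- Elements `γ i` of `A` and `b s` supported in a neighbourhood `W` of `x` with disjoint
  -- translates `γ i • W`; there are enough of them for two applications of the pigeonhole
  -- principle to the map that sends `g` to some `p ∈ P` with `g * p * g⁻¹ ∈ H`.
  obtain ⟨γ, hγA, hγU, hγ⟩ := h.exists_seq hU hA hx
  let S := Fin (Fintype.card P + 1)
  let I := Fin (Fintype.card (S → P) + 1)
  have hW : ∃ W, IsOpen W ∧ x ∈ W ∧ W ⊆ U ∧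
      ∀ i j : I, i ≠ j → Disjoint (((γ i)⁻¹ * γ j) • W) W := by
    have h1 : ∀ i j : I, ∃ W, IsOpen W ∧ x ∈ W ∧ W ⊆ U ∧
        (i ≠ j → Disjoint (((γ i)⁻¹ * γ j) • W) W) := by
      intro i j
      by_cases hij : i = j
      · exact ⟨U, hU, hx, subset_rfl, fun h => (h hij).elim⟩
      · have hne : ((γ i)⁻¹ * γ j) • x ≠ x := by
          rw [mul_smul, Ne, inv_smul_eq_iff]
          exact fun he => hij (Fin.ext (hγ he).symm)
        obtain ⟨W, h1, h2, h3, h4⟩ := exists_open_disjoint_smul hne hU hx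
        exact ⟨W, h1, h2, h3, fun _ => h4⟩
    choose W hWo hxW hWU hWd using h1
    refine ⟨⋂ i, ⋂ j, W i j, isOpen_iInter_of_finite fun i => isOpen_iInter_of_finite fun j =>
      hWo i j, Set.mem_iInter₂.2 hxW, (Set.iInter₂_subset 0 0).trans (hWU 0 0), fun i j hij => ?_⟩
    exact (hWd i j hij).mono (Set.smul_set_mono (Set.iInter₂_subset i j)) (Set.iInter₂_subset i j)
  obtain ⟨W, hWo, hxW, hWU, hWd⟩ := hW
  have hAW := relIndex_rigidStabilizer_ne_zero_of_subset hWU hA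
  obtain ⟨b, -, hbW, hb⟩ := h.exists_seq hWo hAW hxW
  have hbU : ∀ s, b s ∈ rigidStabilizer G U := fun s => rigidStabilizer_mono hWU (hbW s)
  have hmem : ∀ i s, γ i * (b s)⁻¹ ∈ rigidStabilizer G U := fun i s =>
    mul_mem (hγU i) (inv_mem (hbU s))
  choose col hcol hcolH using fun (i : I) (s : S) => hH _ (hmem i s)
  obtain ⟨i, j, hij, hcij⟩ := Fintype.exists_ne_map_eq_of_card_lt
    (fun (i : I) (s : S) => (⟨col i s, hcol i s⟩ : P)) (by simp [I])
  obtain ⟨s, t, hst, hcst⟩ := Fintype.exists_ne_map_eq_of_card_lt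
    (fun s : S => (⟨col i s, hcol i s⟩ : P)) (by simp [S])
  have hct : col i t = col i s := (congrArg Subtype.val hcst).symm
  have hcjs : col j s = col i s := (congrArg Subtype.val (congrFun hcij s)).symm
  have hcjt : col j t = col i s := (congrArg Subtype.val (congrFun hcij t)).symm.trans hct
  have key₁ := (mul_inv_mul_conj_mem (hP _ (hcol i s)) (hmem i s) (hmem i t) (hcolH i s)
    (hct ▸ hcolH i t)).1
  have key₂ := (mul_inv_mul_conj_mem (hP _ (hcol i s)) (hmem j s) (hmem j t) (hcjs ▸ hcolH j s)
    (hcjt ▸ hcolH j t)).1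
  set β := (b s)⁻¹ * b t with hβ
  have hβW : β ∈ rigidStabilizer G W := mul_mem (inv_mem (hbW s)) (hbW t)
  -- The two elements of `H` agree outside of `U`, so their quotient is supported in `U`.
  have hquot : γ i * β * (γ i)⁻¹ * (γ j * β * (γ j)⁻¹)⁻¹ ∈ H := by
    have h1 := mul_mem key₁ (inv_mem key₂)
    convert h1 using 1
    rw [hβ]; group
  have hβU := rigidStabilizer_mono hWU hβW
  have hM : γ i * β * (γ i)⁻¹ * (γ j * β * (γ j)⁻¹)⁻¹ ∈ H ⊓ rigidStabilizer G U :=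
    ⟨hquot, Subgroup.mul_mem _ (mul_mem (mul_mem (hγU i) hβU) (inv_mem (hγU i)))
      (Subgroup.inv_mem _ (mul_mem (mul_mem (hγU j) hβU) (inv_mem (hγU j))))⟩
  refine ⟨_, conj_extendable (inv_mem (hγA i)) hM, ?_⟩
  have h1 := mem_rigidStabilizer.1
    (conj_mem_rigidStabilizer (inv_mem hβW) ((γ i)⁻¹ * γ j)) x
      (Set.disjoint_right.1 (hWd i j hij) hxW)
  have h2 : (γ i)⁻¹ * (γ i * β * (γ i)⁻¹ * (γ j * β * (γ j)⁻¹)⁻¹) * (γ i)⁻¹⁻¹ =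
      β * ((γ i)⁻¹ * γ j * β⁻¹ * ((γ i)⁻¹ * γ j)⁻¹) := by group
  rw [h2, mul_smul, h1, hβ, mul_smul, Ne, inv_smul_eq_iff]
  exact fun he => hst (Fin.ext (hb he).symm)

end MovesEveryPoint

namespace LFRootedTree

/-! ### Ancestors, levels and rays -/

section Tree

variable {V : Type u} {T : LFRootedTree V}

theorem level_root : T.level T.root = 0 := SimpleGraph.dist_self

theorem mem_subtree_self (v : V) : v ∈ T.subtree v := by
  change T.level v = T.level v + T.graph.dist v v
  rw [SimpleGraph.dist_self, add_zero]

theorem level_le_of_mem_subtree {v w : V} (h : w ∈ T.subtree v) : T.level v ≤ T.level w :=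
  (show T.level w = _ from h) ▸ Nat.le_add_right _ _

theorem level_le_add_dist (v w : V) : T.level w ≤ T.level v + T.graph.dist v w :=
  T.isTree.connected.dist_triangle

theorem mem_subtree_of_dist_le {v w : V} (h : T.level v + T.graph.dist v w ≤ T.level w) :
    w ∈ T.subtree v :=
  le_antisymm (level_le_add_dist v w) h

theorem mem_subtree_trans {v w z : V} (hw : w ∈ T.subtree v) (hz : z ∈ T.subtree w) :
    z ∈ T.subtree v := by
  refine mem_subtree_of_dist_le ?_
  have h1 : T.level w = T.level v + T.graph.dist v w := hw
  have h2 : T.level z = T.level w + T.graph.dist w z := hz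
  have h3 : T.graph.dist v z ≤ T.graph.dist v w + T.graph.dist w z :=
    T.isTree.connected.dist_triangle
  omega

/-- The ancestors of a vertex form a chain, since geodesics in a tree are unique. -/
theorem mem_subtree_of_common {v w z : V} (hv : z ∈ T.subtree v) (hw : z ∈ T.subtree w)
    (h : T.level v ≤ T.level w) : w ∈ T.subtree v := by
  obtain ⟨p, hp⟩ := T.isTree.connected.exists_walk_length_eq_dist T.root v
  obtain ⟨q, hq⟩ := T.isTree.connected.exists_walk_length_eq_dist v z
  obtain ⟨p', hp'⟩ := T.isTree.connected.exists_walk_length_eq_dist T.root w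
  obtain ⟨q', hq'⟩ := T.isTree.connected.exists_walk_length_eq_dist w z
  have h1 : (p.append q).IsPath := SimpleGraph.Walk.isPath_of_length_eq_dist _ (by
    rw [SimpleGraph.Walk.length_append, hp, hq]; exact (show T.level z = _ from hv).symm)
  have h2 : (p'.append q').IsPath := SimpleGraph.Walk.isPath_of_length_eq_dist _ (by
    rw [SimpleGraph.Walk.length_append, hp', hq']; exact (show T.level z = _ from hw).symm)
  have h3 : p.append q = p'.append q' := congrArg Subtype.val
    ((T.isTree.isAcyclic.subsingleton_path T.root z).elim ⟨_, h1⟩ ⟨_, h2⟩)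
  replace hp : p.length = T.level v := hp
  replace hp' : p'.length = T.level w := hp'
  have h4 : p'.getVert (T.level v) = v := by
    have h5 := congrArg (fun r => r.getVert (T.level v)) h3
    simp only [SimpleGraph.Walk.getVert_append, hp, hp', lt_irrefl, if_false, Nat.sub_self,
      SimpleGraph.Walk.getVert_zero] at h5
    rcases h.lt_or_eq with hlt | heq
    · rw [if_pos hlt] at h5
      exact h5.symm
    · rw [if_neg heq.not_lt, heq, Nat.sub_self, SimpleGraph.Walk.getVert_zero] at h5
      rw [heq, ← hp', SimpleGraph.Walk.getVert_length, h5]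
  have h5 := SimpleGraph.dist_le ((p'.drop (T.level v)).copy h4 rfl)
  rw [SimpleGraph.Walk.length_copy, SimpleGraph.Walk.drop_length, hp'] at h5
  refine mem_subtree_of_dist_le ?_
  omega

theorem eq_of_mem_subtree_of_level_eq {v w : V} (hw : w ∈ T.subtree v)
    (h : T.level v = T.level w) : v = w := by
  have h1 : T.level w = T.level v + T.graph.dist v w := hw
  exact (T.isTree.connected.dist_eq_zero_iff).1 (by omega)

theorem exists_adj_of_level_eq_succ {w : V} {n : ℕ} (h : T.level w = n + 1) :
    ∃ v, T.level v = n ∧ T.graph.Adj v w := by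
  obtain ⟨p, hp⟩ := T.isTree.connected.exists_walk_length_eq_dist w T.root
  rw [SimpleGraph.dist_comm, show T.graph.dist T.root w = n + 1 from h] at hp
  cases p with
  | nil => simp at hp
  | @cons _ v _ hadj q =>
    refine ⟨v, ?_, hadj.symm⟩
    have h1 := SimpleGraph.dist_le q
    rw [SimpleGraph.dist_comm] at h1
    have h2 := level_le_add_dist (T := T) v w
    rw [SimpleGraph.dist_eq_one_iff_adj.2 hadj.symm] at h2
    rw [SimpleGraph.Walk.length_cons] at hp
    have h3 : T.graph.dist T.root v = T.level v := rfl
    omega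

theorem mem_subtree_of_adj {v w : V} (h : T.graph.Adj v w) (hl : T.level w = T.level v + 1) :
    w ∈ T.subtree v :=
  mem_subtree_of_dist_le (by rw [SimpleGraph.dist_eq_one_iff_adj.2 h, hl])

variable (T) in
theorem finite_level (n : ℕ) : {v | T.level v = n}.Finite := by
  induction n with
  | zero =>
    refine (Set.finite_singleton T.root).subset fun v hv => ?_
    exact ((T.isTree.connected.dist_eq_zero_iff).1 hv).symm
  | succ n ih =>
    refine (ih.biUnion fun v _ => T.locallyFinite v).subset fun w hw => ?_
    obtain ⟨v, hv, hvw⟩ := exists_adj_of_level_eq_succ hw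
    exact Set.mem_biUnion hv hvw

theorem finite_ancestors (w : V) : {v | w ∈ T.subtree v}.Finite := by
  refine ((Set.finite_Iic (T.level w)).biUnion fun n _ => T.finite_level n).subset fun v hv => ?_
  exact Set.mem_biUnion (Set.mem_Iic.2 (level_le_of_mem_subtree hv)) rfl

theorem ray_mem_subtree (ξ : T.Boundary) {n m : ℕ} (h : n ≤ m) : ξ.1 m ∈ T.subtree (ξ.1 n) := by
  induction m, h using Nat.le_induction with
  | base => exact mem_subtree_self _
  | succ m _ ih =>
    refine mem_subtree_trans ih (mem_subtree_of_adj (ξ.2.2 m) ?_)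
    rw [ξ.2.1, ξ.2.1]

theorem mem_cylinder_ray (ξ : T.Boundary) (n : ℕ) : ξ ∈ T.cylinder (ξ.1 n) := by
  change ξ.1 (T.level (ξ.1 n)) = ξ.1 n
  rw [ξ.2.1]

theorem mem_cylinder_iff_mem_subtree {ξ : T.Boundary} {v : V} {n : ℕ} (h : T.level v ≤ n) :
    ξ ∈ T.cylinder v ↔ ξ.1 n ∈ T.subtree v := by
  constructor
  · intro hξ
    have h1 := ray_mem_subtree ξ h
    rwa [show ξ.1 (T.level v) = v from hξ] at h1
  · intro hn
    have h1 := ray_mem_subtree ξ h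
    have h2 := mem_subtree_of_common hn h1 (ξ.2.1 _).ge
    exact (eq_of_mem_subtree_of_level_eq h2 (ξ.2.1 _).symm).symm

theorem cylinder_subset_of_mem_subtree {v w : V} (h : w ∈ T.subtree v) :
    T.cylinder w ⊆ T.cylinder v := fun ξ hξ => by
  rw [mem_cylinder_iff_mem_subtree (level_le_of_mem_subtree h)]
  rwa [show ξ.1 (T.level w) = w from hξ]

theorem disjoint_cylinder {v w : V} (hne : v ≠ w) (hl : T.level v = T.level w) :
    Disjoint (T.cylinder v) (T.cylinder w) :=
  Set.disjoint_left.2 fun ξ hv hw => hne (by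
    rw [← show ξ.1 (T.level v) = v from hv, hl]; exact hw)

theorem cylinder_ray_anti (ξ : T.Boundary) {n m : ℕ} (h : n ≤ m) :
    T.cylinder (ξ.1 m) ⊆ T.cylinder (ξ.1 n) :=
  cylinder_subset_of_mem_subtree (ray_mem_subtree ξ h)

end Tree

/-! ### The topology of the boundary -/

section Boundary

variable {V : Type u} (T : LFRootedTree V)

instance : CompactSpace T.Boundary := by
  let _ : TopologicalSpace V := ⊥
  have : DiscreteTopology V := ⟨rfl⟩
  let S : Set (ℕ → V) := {ξ | (∀ n, T.level (ξ n) = n) ∧ ∀ n, T.graph.Adj (ξ n) (ξ (n + 1))}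
  suffices h : IsCompact S from isCompact_iff_compactSpace.1 h
  have hc : IsCompact (Set.pi Set.univ fun n => {v | T.level v = n}) :=
    isCompact_univ_pi fun n => (T.finite_level n).isCompact
  have hcl : IsClosed {ξ : ℕ → V | ∀ n, T.graph.Adj (ξ n) (ξ (n + 1))} := by
    simp only [Set.ofPred_forall]
    refine isClosed_iInter fun n => ?_
    exact (isClosed_discrete {x : V × V | T.graph.Adj x.1 x.2}).preimage
      (f := fun ξ : ℕ → V => (ξ n, ξ (n + 1))) (by fun_prop)
  convert hc.inter_right hcl using 1
  ext ξ
  simp [S, Set.mem_pi]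

theorem isClosed_cylinder (v : V) : IsClosed (T.cylinder v) := by
  let _ : TopologicalSpace V := ⊥
  have : DiscreteTopology V := ⟨rfl⟩
  have h : Continuous fun ξ : T.Boundary => ξ.1 (T.level v) :=
    (continuous_apply (T.level v)).comp continuous_induced_dom
  exact (isClosed_discrete ({v} : Set V)).preimage h

theorem isCompact_cylinder (v : V) : IsCompact (T.cylinder v) := (T.isClosed_cylinder v).isCompact

variable {T}

theorem exists_cylinder_subset {U : Set T.Boundary} (hU : IsOpen U) {ξ : T.Boundary} (hξ : ξ ∈ U) :
    ∃ n, ∀ m ≥ n, T.cylinder (ξ.1 m) ⊆ U := by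
  obtain ⟨n, hn⟩ := exists_subset_nhds_of_isCompact' (V := fun n => T.cylinder (ξ.1 n)) (U := U)
    (directed_of_isDirected_le fun n m h => cylinder_ray_anti ξ h)
    (fun n => T.isCompact_cylinder _) (fun n => T.isClosed_cylinder _) (fun η hη => by
      have : η = ξ := Subtype.ext (funext fun n => by
        have h1 := Set.mem_iInter.1 hη n
        rw [← show η.1 (T.level (ξ.1 n)) = ξ.1 n from h1, ξ.2.1])
      rw [this]
      exact hU.mem_nhds hξ)
  exact ⟨n, fun m hm => (cylinder_ray_anti ξ hm).trans hn⟩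

theorem smul_cylinder (g : T.Aut) (v : V) : g • T.cylinder v = T.cylinder (g • v) := by
  ext ξ
  rw [Set.mem_smul_set_iff_inv_smul_mem]
  change g⁻¹ • ξ.1 (T.level v) = v ↔ ξ.1 (T.level (g • v)) = g • v
  rw [level_smul, inv_smul_eq_iff]

end Boundary

/-! ### Weakly branch groups move every point -/

section WeaklyBranch

variable {V : Type u} {T : LFRootedTree V} {G : Subgroup T.Aut}

instance : ContinuousConstSMul G T.Boundary :=
  ⟨fun g => continuous_const_smul (g : T.Aut)⟩

theorem smul_mem_cylinder {g : G} {ξ : T.Boundary} {v : V} (h : ξ ∈ T.cylinder v) :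
    g • ξ ∈ T.cylinder (g • v) := by
  have h1 := Set.smul_mem_smul_set (a := (g : T.Aut)) h
  rwa [smul_cylinder] at h1

theorem smul_cylinder_subgroup (g : G) (v : V) : g • T.cylinder v = T.cylinder (g • v) :=
  smul_cylinder (g : T.Aut) v

theorem level_smul_subgroup (g : G) (v : V) : T.level (g • v) = T.level v :=
  level_smul (g : T.Aut) v

theorem conj_mem_rist {v : V} {g : G} (hg : g ∈ rist G v) (a : G) : a * g * a⁻¹ ∈ rist G (a • v) := by
  have h := conj_mem_rigidStabilizer hg a
  rwa [smul_cylinder_subgroup] at h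

theorem rist_le_of_mem_subtree {v w : V} (h : w ∈ T.subtree v) : rist G w ≤ rist G v :=
  rigidStabilizer_mono (cylinder_subset_of_mem_subtree h)

namespace IsWeaklyBranch

variable (hG : IsWeaklyBranch G)
include hG

theorem exists_level_eq (n : ℕ) : ∃ v, T.level v = n := by
  by_contra! h
  have hlt : ∀ m, n ≤ m → ∀ v, T.level v ≠ m := by
    intro m hm
    induction m, hm using Nat.le_induction with
    | base => exact h
    | succ m _ ih =>
      intro v hv
      obtain ⟨w, hw, -⟩ := exists_adj_of_level_eq_succ hv
      exact ih w hw
  have := hG.infinite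
  refine Set.infinite_univ (α := V) (((Set.finite_Iio n).biUnion fun k _ =>
    T.finite_level k).subset fun v _ => Set.mem_biUnion (Set.mem_Iio.2 ?_) rfl)
  by_contra hv
  exact hlt _ (not_lt.1 hv) v rfl

theorem exists_child (v : V) : ∃ w, T.graph.Adj v w ∧ T.level w = T.level v + 1 := by
  obtain ⟨w, hw⟩ := hG.exists_level_eq (T.level v + 1)
  obtain ⟨v', hv', hadj⟩ := exists_adj_of_level_eq_succ hw
  obtain ⟨g, rfl⟩ := hG.levelTransitive v' v hv'
  exact ⟨g • w, smul_adj (g : T.Aut) hadj, by rw [level_smul_subgroup, hw]⟩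

theorem cylinder_nonempty (v : V) : (T.cylinder v).Nonempty := by
  choose c hc hcl using hG.exists_child
  have hl : ∀ n, T.level (c^[n] T.root) = n := by
    intro n
    induction n with
    | zero => exact level_root
    | succ n ih => rw [Function.iterate_succ_apply', hcl, ih]
  let ξ : T.Boundary := ⟨fun n => c^[n] T.root, hl, fun n => by
    change T.graph.Adj (c^[n] T.root) (c^[n + 1] T.root)
    rw [Function.iterate_succ_apply']; exact hc _⟩
  obtain ⟨g, hg⟩ := hG.levelTransitive (ξ.1 (T.level v)) v (ξ.2.1 _)
  exact ⟨g • ξ, hg ▸ smul_mem_cylinder (mem_cylinder_ray ξ _)⟩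

theorem faithfulSMul : FaithfulSMul G T.Boundary := by
  refine ⟨fun {g h} hgh => Subtype.ext (Subtype.ext (RelIso.ext fun v => ?_))⟩
  obtain ⟨ξ, hξ⟩ := hG.cylinder_nonempty v
  have h1 : g • ξ.1 (T.level v) = h • ξ.1 (T.level v) :=
    congrFun (congrArg Subtype.val (hgh ξ)) (T.level v)
  rw [show ξ.1 (T.level v) = v from hξ] at h1
  exact h1

/-- The fixed points of `rist G v` in `∂T_v` form a closed set that is invariant under the
stabilizer of `v`, which acts on `∂T_v` with dense orbits. -/
theorem movesEveryPoint : MovesEveryPoint G T.Boundary := by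
  intro U hU ξ hξ
  obtain ⟨n, hn⟩ := exists_cylinder_subset hU hξ
  by_contra! hfix
  have hfaith := hG.faithfulSMul
  set v := ξ.1 n with hv
  obtain ⟨⟨g, hg⟩, hg1⟩ := Subgroup.ne_bot_iff_exists_ne_one.1
    (hG.microSupported (T.cylinder v) (T.isOpen_cylinder v) ⟨ξ, mem_cylinder_ray ξ n⟩)
  replace hg1 : g ≠ 1 := fun h => hg1 (Subtype.ext h)
  refine hg1 (FaithfulSMul.eq_of_smul_eq_smul (α := T.Boundary) fun η => ?_)
  rw [one_smul]
  by_cases hη : η ∈ T.cylinder v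
  swap
  · exact mem_rigidStabilizer.1 hg η hη
  have hfixm : ∀ m ≥ n, g • η.1 m = η.1 m := by
    intro m hm
    obtain ⟨h, hh⟩ := hG.levelTransitive (ξ.1 m) (η.1 m) (by rw [ξ.2.1, η.2.1])
    have hhv : h⁻¹ • v = v := by
      have h2 : η.1 n = v := by
        have h3 : η.1 (T.level v) = v := hη
        rwa [hv, ξ.2.1] at h3
      have h4 : η.1 m ∈ T.subtree (h • v) := by
        rw [← hh]
        exact smul_mem_subtree (h : T.Aut) (ray_mem_subtree ξ hm)
      have h5 : η.1 m ∈ T.subtree v := h2 ▸ ray_mem_subtree η hm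
      have h6 := mem_subtree_of_common h4 h5 (level_smul_subgroup h v).le
      have h7 := eq_of_mem_subtree_of_level_eq h6 (level_smul_subgroup h v)
      rw [inv_smul_eq_iff, h7]
    have hconj := conj_mem_rist (v := v) hg h⁻¹
    rw [hhv] at hconj
    have h1 := hfix _ (rigidStabilizer_mono (hn n le_rfl) hconj)
    have h2 : (h⁻¹ * g * h⁻¹⁻¹) • ξ.1 m = ξ.1 m := congrFun (congrArg Subtype.val h1) m
    rw [inv_inv, mul_smul, mul_smul, hh, inv_smul_eq_iff, hh] at h2
    exact h2
  refine Subtype.ext (funext fun k => ?_)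
  change g • η.1 k = η.1 k
  rcases le_total n k with hk | hk
  · exact hfixm k hk
  · have h1 := ray_mem_subtree (g • η) hk
    have h2 := ray_mem_subtree η hk
    have h3 : (g • η).1 n = η.1 n := hfixm n le_rfl
    rw [h3] at h1
    have h4 : T.level ((g • η).1 k) = T.level (η.1 k) := by rw [(g • η).2.1, η.2.1]
    exact eq_of_mem_subtree_of_level_eq (mem_subtree_of_common h1 h2 h4.le) h4

end IsWeaklyBranch

end WeaklyBranch

end LFRootedTree

/-! ### Recurrence in uniformly recurrent subgroups -/

section Chabauty

variable {G : Type u} [Group G]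

open Classical in
theorem isInducing_decide_mem :
    Topology.IsInducing fun (H : Subgroup G) (g : G) => decide (g ∈ H) :=
  ⟨rfl⟩

theorem isClopen_setOf_mem (g : G) : IsClopen {H : Subgroup G | g ∈ H} := by
  classical
  have h := (continuous_apply g).comp (isInducing_decide_mem (G := G)).continuous
  have h2 := (isClopen_discrete ({true} : Set Bool)).preimage h
  simpa [Set.preimage] using h2

theorem mem_conj_smul {g k : G} {H : Subgroup G} : k ∈ MulAut.conj g • H ↔ g⁻¹ * k * g ∈ H := by
  rw [Subgroup.mem_pointwise_smul_iff_inv_smul_mem, ← map_inv, MulAut.smul_def, MulAut.conj_apply,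
    inv_inv]

theorem conj_smul_conj_smul (g k : G) (H : Subgroup G) :
    MulAut.conj g • MulAut.conj k • H = MulAut.conj (g * k) • H := by
  rw [map_mul, mul_smul]

theorem conj_inv_smul_conj_smul (g : G) (H : Subgroup G) :
    MulAut.conj g⁻¹ • MulAut.conj g • H = H := by
  rw [conj_smul_conj_smul, inv_mul_cancel, map_one, one_smul]

theorem continuous_conj_smul (g : G) : Continuous fun H : Subgroup G => MulAut.conj g • H := by
  refine (isInducing_decide_mem (G := G)).continuous_iff.2 (continuous_pi fun k => ?_)
  have h : ∀ H : Subgroup G, (k ∈ MulAut.conj g • H) = (g⁻¹ * k * g ∈ H) := fun H =>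
    propext mem_conj_smul
  refine (continuous_bool_rng true).2 ?_
  convert isClopen_setOf_mem (g⁻¹ * k * g) using 1
  ext H
  simp [h]

instance : CompactSpace (Subgroup G) := by
  classical
  let f : Subgroup G → G → Bool := fun H g => decide (g ∈ H)
  refine ⟨(isInducing_decide_mem (G := G)).isCompact_iff.2 (IsClosed.isCompact ?_)⟩
  have hrange : f '' Set.univ = {φ : G → Bool | φ 1 = true} ∩
      ({φ | ∀ a b, φ a = true → φ b = true → φ (a * b) = true} ∩
        {φ | ∀ a, φ a = true → φ a⁻¹ = true}) := by
    ext φ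
    constructor
    · rintro ⟨H, -, rfl⟩
      simp only [f, Set.mem_inter_iff, Set.mem_ofPred_eq, decide_eq_true_eq]
      exact ⟨H.one_mem, fun a b => H.mul_mem, fun a => H.inv_mem⟩
    · rintro ⟨h1, h2, h3⟩
      refine ⟨⟨⟨⟨{g | φ g = true}, fun {a b} => h2 a b⟩, h1⟩, fun {a} => h3 a⟩, trivial, ?_⟩
      ext g
      simp only [f, ← Subgroup.mem_carrier, Set.mem_ofPred_eq, Bool.decide_eq_true]
  have hc : ∀ g, IsClosed {φ : G → Bool | φ g = true} := fun g =>
    (isClosed_discrete ({true} : Set Bool)).preimage (continuous_apply (A := fun _ => Bool) g)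
  have ho : ∀ g, IsOpen {φ : G → Bool | φ g = true} := fun g =>
    (isOpen_discrete ({true} : Set Bool)).preimage (continuous_apply (A := fun _ => Bool) g)
  rw [hrange]
  refine (hc 1).inter (IsClosed.inter ?_ ?_)
  · simp only [Set.ofPred_forall]
    exact isClosed_iInter fun a => isClosed_iInter fun b => isClosed_imp (ho a)
      (isClosed_imp (ho b) (hc _))
  · simp only [Set.ofPred_forall]
    exact isClosed_iInter fun a => isClosed_imp (ho a) (hc _)

/-- The closure of the set of conjugates of `H` by elements of `N`. -/
def conjClosure (N H : Subgroup G) : Set (Subgroup G) :=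
  closure {K | ∃ a ∈ N, MulAut.conj a • H = K}

theorem self_mem_conjClosure (N H : Subgroup G) : H ∈ conjClosure N H :=
  subset_closure ⟨1, one_mem N, by rw [map_one, one_smul]⟩

theorem conj_smul_mem_conjClosure {N H K : Subgroup G} (hK : K ∈ conjClosure N H) {a : G}
    (ha : a ∈ N) : MulAut.conj a • K ∈ conjClosure N H := by
  refine map_mem_closure (continuous_conj_smul a) hK ?_
  rintro _ ⟨b, hb, rfl⟩
  exact ⟨a * b, mul_mem ha hb, (conj_smul_conj_smul a b H).symm⟩

theorem conjClosure_subset {N H K : Subgroup G} (hK : K ∈ conjClosure N H) :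
    conjClosure N K ⊆ conjClosure N H := by
  refine closure_minimal ?_ isClosed_closure
  rintro _ ⟨a, ha, rfl⟩
  exact conj_smul_mem_conjClosure hK ha

theorem conj_smul_mem_conjClosure_conj {N H K : Subgroup G} [hN : N.Normal]
    (hK : K ∈ conjClosure N H) (t : G) :
    MulAut.conj t • K ∈ conjClosure N (MulAut.conj t • H) := by
  refine map_mem_closure (continuous_conj_smul t) hK ?_
  rintro _ ⟨a, ha, rfl⟩
  exact ⟨t * a * t⁻¹, hN.conj_mem a ha t, by simp only [conj_smul_conj_smul, inv_mul_cancel_right]⟩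

/-- A point of a minimal `G`-system is uniformly recurrent for the finite-index subgroup `N`: the
closure of its `N`-orbit is a minimal `N`-system. By minimality for `G`, the closure of the
`N`-orbit of `K` contains a conjugate of `H` by some `s`. Thus conjugation by `s` maps the closure
of the `N`-orbit of `H` into itself, and it does so bijectively, because a power of `s` lies
in `N`. -/
theorem IsURS.mem_conjClosure_of_mem {𝓗 : Set (Subgroup G)} (h𝓗 : IsURS 𝓗) {N : Subgroup G}
    [hN : N.Normal] [N.FiniteIndex] {H K : Subgroup G} (hH : H ∈ 𝓗) (hK : K ∈ conjClosure N H) :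
    H ∈ conjClosure N K := by
  have hsub : ∀ L ∈ 𝓗, conjClosure N L ⊆ 𝓗 := fun L hL => closure_minimal
    (by rintro _ ⟨a, -, rfl⟩; exact h𝓗.invariant a L hL) h𝓗.isClosed
  have hK𝓗 : K ∈ 𝓗 := hsub H hH hK
  let 𝓚 : Set (Subgroup G) :=
    ⋃ q : G ⧸ N, {L | MulAut.conj (q.out : G)⁻¹ • L ∈ conjClosure N K}
  have h𝓚 : 𝓚 = 𝓗 := by
    refine h𝓗.minimal 𝓚 ?_ ?_ ?_ ?_
    · intro L hL
      obtain ⟨q, hq⟩ := Set.mem_iUnion.1 hL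
      have h1 := h𝓗.invariant q.out _ (hsub K hK𝓗 hq)
      rwa [conj_smul_conj_smul, mul_inv_cancel, map_one, one_smul] at h1
    · refine ⟨MulAut.conj ((1 : G) : G ⧸ N).out • K, Set.mem_iUnion.2 ⟨((1 : G) : G ⧸ N), ?_⟩⟩
      change _ ∈ conjClosure N K
      rw [conj_inv_smul_conj_smul]
      exact self_mem_conjClosure N K
    · exact isClosed_iUnion_of_finite fun q =>
        (isClosed_closure (s := {L | ∃ a ∈ N, MulAut.conj a • K = L})).preimage
          (continuous_conj_smul _)
    · intro g L hL
      obtain ⟨q, hq⟩ := Set.mem_iUnion.1 hL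
      let q' : G ⧸ N := ((g * q.out : G) : G ⧸ N)
      have hn : q'.out⁻¹ * (g * q.out) ∈ N := QuotientGroup.eq.1 q'.out_eq'
      refine Set.mem_iUnion.2 ⟨q', ?_⟩
      have h1 := conj_smul_mem_conjClosure hq hn
      rw [conj_smul_conj_smul] at h1
      change _ ∈ conjClosure N K
      rw [conj_smul_conj_smul]
      convert h1 using 3
      group
  obtain ⟨q, hq⟩ := Set.mem_iUnion.1 (h𝓚.symm ▸ hH : H ∈ 𝓚)
  change _ ∈ conjClosure N K at hq
  set s : G := (q.out : G)⁻¹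
  have hsH : MulAut.conj s • H ∈ conjClosure N H := conjClosure_subset hK hq
  have hpow : ∀ k : ℕ, MulAut.conj (s ^ (k + 1)) • H ∈ conjClosure N (MulAut.conj s • H) := by
    intro k
    induction k with
    | zero => rw [zero_add, pow_one]; exact self_mem_conjClosure _ _
    | succ k ih =>
      have h1 := conj_smul_mem_conjClosure_conj ih s
      rw [conj_smul_conj_smul s (s ^ (k + 1)), ← pow_succ'] at h1
      exact conjClosure_subset (conj_smul_mem_conjClosure_conj hsH s) h1
  obtain ⟨k, hk0, -, hkN⟩ :=
    Subgroup.exists_pow_mem_of_index_ne_zero (H := N) Subgroup.FiniteIndex.index_ne_zero s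
  obtain ⟨k, rfl⟩ := Nat.exists_eq_succ_of_ne_zero hk0.ne'
  have h1 := conj_smul_mem_conjClosure (hpow k) (inv_mem hkN)
  rw [conj_inv_smul_conj_smul] at h1
  exact conjClosure_subset hq h1

/-- Uniform recurrence in terms of elements: some finite set of `N`-conjugates of `h ∈ H` meets every
`N`-conjugate of `H`. -/
theorem IsURS.exists_finset_confining {𝓗 : Set (Subgroup G)} (h𝓗 : IsURS 𝓗) {N : Subgroup G}
    [hN : N.Normal] [N.FiniteIndex] {H : Subgroup G} (hH : H ∈ 𝓗) {h : G} (hh : h ∈ H) :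
    ∃ P : Finset G, (∀ p ∈ P, ∃ a ∈ N, p = a⁻¹ * h * a) ∧ ∀ g ∈ N, ∃ p ∈ P, g * p * g⁻¹ ∈ H := by
  classical
  have hcomp : IsCompact (conjClosure N H) := isClosed_closure.isCompact
  obtain ⟨t, ht⟩ := hcomp.elim_finite_subcover (fun a : N => {K | (a : G)⁻¹ * h * a ∈ K})
    (fun a => (isClopen_setOf_mem _).isOpen) (by
      intro K hK
      by_contra hcon
      have h1 : conjClosure N K ⊆ {L | h ∈ L}ᶜ := by
        refine closure_minimal ?_ (isClopen_setOf_mem h).isOpen.isClosed_compl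
        rintro _ ⟨a, ha, rfl⟩ hmem
        exact hcon (Set.mem_iUnion.2 ⟨⟨a, ha⟩, mem_conj_smul.1 hmem⟩)
      exact h1 (h𝓗.mem_conjClosure_of_mem hH hK) hh)
  refine ⟨t.image fun a : N => (a : G)⁻¹ * h * a, ?_, fun g hg => ?_⟩
  · intro p hp
    obtain ⟨a, -, rfl⟩ := Finset.mem_image.1 hp
    exact ⟨a, a.2, rfl⟩
  · obtain ⟨a, ha, hm⟩ := Set.mem_iUnion₂.1
      (ht (conj_smul_mem_conjClosure (self_mem_conjClosure N H) (inv_mem hg)))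
    refine ⟨_, Finset.mem_image_of_mem _ ha, ?_⟩
    have h1 := mem_conj_smul.1 hm
    rwa [inv_inv] at h1

section UpperSemicontinuous

variable {V : Type*} [MulAction G V] {𝓗 : Set (Subgroup G)} {Λ : Set V} {E : Subgroup G → Set V}

/-- An upper semicontinuous equivariant map from a URS to the subsets of a finite set takes values
of constant cardinality. -/
theorem IsURS.ncard_eq (h𝓗 : IsURS 𝓗) (hΛ : Λ.Finite) (hE : ∀ H, E H ⊆ Λ)
    (hcl : ∀ v, IsClosed {H | v ∈ E H}) (hequiv : ∀ (g : G) H, ∀ v ∈ E H,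
      g • v ∈ E (MulAut.conj g • H)) {H K : Subgroup G} (hH : H ∈ 𝓗) (hK : K ∈ 𝓗) :
    (E H).ncard = (E K).ncard := by
  have key : ∀ {H K : Subgroup G}, H ∈ 𝓗 → K ∈ 𝓗 → (E H).ncard ≤ (E K).ncard := by
    intro H K hH hK
    let 𝓚 := 𝓗 ∩ ⋃ S ∈ {S | S ⊆ Λ ∧ (E H).ncard ≤ S.ncard}, ⋂ v ∈ S, {L | v ∈ E L}
    have hmem : ∀ L, L ∈ 𝓚 ↔ L ∈ 𝓗 ∧ (E H).ncard ≤ (E L).ncard := by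
      intro L
      refine and_congr_right fun _ => ⟨fun h => ?_, fun h => ?_⟩
      · obtain ⟨S, hS, hSL⟩ := Set.mem_iUnion₂.1 h
        exact hS.2.trans (Set.ncard_le_ncard (fun v hv => Set.mem_iInter₂.1 hSL v hv)
          (hΛ.subset (hE L)))
      · exact Set.mem_iUnion₂.2 ⟨E L, ⟨hE L, h⟩, Set.mem_iInter₂.2 fun v hv => hv⟩
    have h𝓚 : 𝓚 = 𝓗 := by
      refine h𝓗.minimal 𝓚 Set.inter_subset_left ⟨H, (hmem H).2 ⟨hH, le_rfl⟩⟩ ?_ ?_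
      · refine h𝓗.isClosed.inter (Set.Finite.isClosed_biUnion ?_ fun S _ =>
          isClosed_biInter fun v _ => hcl v)
        exact hΛ.finite_subsets.subset fun S hS => hS.1
      · intro g L hL
        rw [hmem] at hL ⊢
        refine ⟨h𝓗.invariant g L hL.1, hL.2.trans ?_⟩
        refine Set.ncard_le_ncard_of_injOn (fun v => g • v) (fun v hv => hequiv g L v hv)
          (MulAction.injective g).injOn (hΛ.subset (hE _))
    exact ((hmem K).1 (h𝓚.symm ▸ hK)).2
  exact le_antisymm (key hH hK) (key hK hH)

/-- An upper semicontinuous map to the subsets of a finite set whose values all have the same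
cardinality is locally constant. -/
theorem IsURS.isClopen_setOf_mem (h𝓗 : IsURS 𝓗) (hΛ : Λ.Finite) (hE : ∀ H, E H ⊆ Λ)
    (hcl : ∀ v, IsClosed {H | v ∈ E H}) (hequiv : ∀ (g : G) H, ∀ v ∈ E H,
      g • v ∈ E (MulAut.conj g • H)) (v : V) : IsClopen {H : 𝓗 | v ∈ E H} := by
  refine ⟨(hcl v).preimage continuous_subtype_val, ?_⟩
  obtain ⟨H₀, hH₀⟩ := h𝓗.nonempty
  rw [← isClosed_compl_iff]
  have heq : {H : 𝓗 | v ∈ E H}ᶜ = ⋃ S ∈ {S | S ⊆ Λ ∧ S.ncard = (E H₀).ncard ∧ v ∉ S},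
      ⋂ w ∈ S, {L : 𝓗 | w ∈ E L} := by
    ext L
    have hcard := h𝓗.ncard_eq hΛ hE hcl hequiv L.2 hH₀
    constructor
    · exact fun h => Set.mem_iUnion₂.2 ⟨E L, ⟨hE L, hcard, h⟩, Set.mem_iInter₂.2 fun w hw => hw⟩
    · intro h hv
      obtain ⟨S, ⟨-, hS, hvS⟩, hSL⟩ := Set.mem_iUnion₂.1 h
      have h1 : S = E L := Set.eq_of_subset_of_ncard_le
        (fun w hw => Set.mem_iInter₂.1 hSL w hw) (hcard.trans hS.symm).le (hΛ.subset (hE L))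
      exact hvS (h1 ▸ hv)
  rw [heq]
  exact Set.Finite.isClosed_biUnion (hΛ.finite_subsets.subset fun S hS => hS.1) fun S _ =>
    isClosed_biInter fun w _ => (hcl w).preimage continuous_subtype_val

end UpperSemicontinuous

end Chabauty

namespace LFRootedTree

variable {V : Type u} {T : LFRootedTree V} {G : Subgroup T.Aut}

/-! ### Fixed points and derived rigid stabilizers -/

section FixedPoints

variable (G) in
/-- The pointwise stabilizer of the `n`-th level. -/
def levelStabilizer (n : ℕ) : Subgroup G where
  carrier := {g | ∀ v, T.level v = n → g • v = v}
  one_mem' := fun _ _ => one_smul _ _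
  mul_mem' := fun {a b} ha hb v hv => by rw [mul_smul, hb v hv, ha v hv]
  inv_mem' := fun {a} ha v hv => by rw [inv_smul_eq_iff, ha v hv]

instance (n : ℕ) : (levelStabilizer G n).Normal :=
  ⟨fun a ha g v hv => by
    rw [mul_smul, mul_smul, ha _ ((level_smul_subgroup g⁻¹ v).trans hv), smul_inv_smul]⟩

instance (n : ℕ) : (levelStabilizer G n).FiniteIndex := by
  have := (T.finite_level n).to_subtype
  let f : G ⧸ levelStabilizer G n → {v | T.level v = n} → {v | T.level v = n} := fun q v =>
    ⟨q.out • v.1, (level_smul_subgroup q.out v.1).trans v.2⟩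
  have hf : Function.Injective f := by
    intro q q' h
    rw [← q.out_eq', ← q'.out_eq']
    refine QuotientGroup.eq.2 fun v hv => ?_
    rw [mul_smul, inv_smul_eq_iff]
    exact (congrArg Subtype.val (congrFun h ⟨v, hv⟩)).symm
  have := Finite.of_injective f hf
  exact ⟨Subgroup.index_ne_zero_of_finite⟩

theorem IsWeaklyBranch.rist_le_levelStabilizer (hG : IsWeaklyBranch G) (v : V) :
    rist G v ≤ levelStabilizer G (T.level v) := by
  intro g hg
  have h1 : ∀ w, T.level w = T.level v → w ≠ v → g • w = w := by
    intro w hw hne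
    obtain ⟨ξ, hξ⟩ := hG.cylinder_nonempty w
    have h1 := mem_rigidStabilizer.1 hg ξ (Set.disjoint_left.1 (disjoint_cylinder hne hw) hξ)
    have h2 : g • ξ.1 (T.level w) = ξ.1 (T.level w) :=
      congrFun (congrArg Subtype.val h1) (T.level w)
    rwa [show ξ.1 (T.level w) = w from hξ] at h2
  intro w hw
  by_cases hne : w = v
  · subst hne
    by_contra hcon
    exact hcon (smul_left_cancel g (h1 (g • w) (level_smul_subgroup g w) hcon))
  · exact h1 w hw hne

/-- Conjugates of an element `h` that moves the vertex `v` by elements fixing the level of `v` also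
move `v`, so recurrence of `H` makes the local commutator lemma applicable in `∂T_v`. -/
theorem IsWeaklyBranch.exists_commutator_rist_le (hG : IsWeaklyBranch G) {𝓗 : Set (Subgroup G)}
    (h𝓗 : IsURS 𝓗) {H : Subgroup G} (hH : H ∈ 𝓗) {ξ : T.Boundary} (hξ : ξ ∉ fixedSet H) :
    ∃ v, ξ ∈ T.cylinder v ∧ ⁅rist G v, rist G v⁆ ≤ H := by
  have hξ' : ∃ h ∈ H, h • ξ ≠ ξ := by
    by_contra! hcon
    exact hξ hcon
  obtain ⟨h, hh, hne⟩ := hξ'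
  have hn : ∃ n, h • ξ.1 n ≠ ξ.1 n := by
    by_contra! hcon
    exact hne (Subtype.ext (funext hcon))
  obtain ⟨n, hn⟩ := hn
  have hlev : T.level (ξ.1 n) = n := ξ.2.1 n
  obtain ⟨P, hP, hPH⟩ := h𝓗.exists_finset_confining (N := levelStabilizer G n) hH hh
  have hfaith := hG.faithfulSMul
  obtain ⟨W, hW, hξW, hle⟩ := hG.movesEveryPoint.exists_commutator_le_of_confined
    (T.isOpen_cylinder (ξ.1 n)) (P := P) (H := H) (by
      intro p hp
      obtain ⟨a, ha, rfl⟩ := hP p hp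
      rw [smul_cylinder_subgroup]
      refine disjoint_cylinder ?_ (level_smul_subgroup _ _)
      rw [mul_smul, mul_smul, ha _ hlev, inv_mem ha _ ((level_smul_subgroup h _).trans hlev)]
      exact hn)
    (fun g hg => hPH g (by
      have h1 := hG.rist_le_levelStabilizer (ξ.1 n) hg
      rwa [hlev] at h1)) (mem_cylinder_ray ξ n)
  obtain ⟨m, hm⟩ := exists_cylinder_subset hW hξW
  exact ⟨ξ.1 m, mem_cylinder_ray ξ m, (Subgroup.commutator_mono
    (rigidStabilizer_mono (hm m le_rfl)) (rigidStabilizer_mono (hm m le_rfl))).trans hle⟩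

theorem IsWeaklyBranch.notMem_fixedSet (hG : IsWeaklyBranch G) {H : Subgroup G} {v : V}
    (hv : ⁅rist G v, rist G v⁆ ≤ H) {ξ : T.Boundary} (hξ : ξ ∈ T.cylinder v) :
    ξ ∉ fixedSet H := by
  intro hfix
  obtain ⟨g, hg, hgξ⟩ := hG.movesEveryPoint _ (T.isOpen_cylinder v) ξ hξ
  obtain ⟨W, hW, hξW, hWv, hgW⟩ := exists_open_disjoint_smul hgξ (T.isOpen_cylinder v) hξ
  obtain ⟨a, ha, haξ⟩ := hG.movesEveryPoint W hW ξ hξW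
  exact commutator_smul_ne hgW ha hξW haξ (hfix _ (hv (Subgroup.commutator_mem_commutator
    (rigidStabilizer_mono hWv ha) hg)))

/-- The vertices of level `n` all of whose descendants `w` of level `m` satisfy
`(rist G w)' ≤ H`. -/
def derivedVertices (m n : ℕ) (H : Subgroup G) : Set V :=
  {v | T.level v = n ∧ ∀ w ∈ T.subtree v, T.level w = m → ⁅rist G w, rist G w⁆ ≤ H}

theorem isClosed_setOf_mem_derivedVertices (m n : ℕ) (v : V) :
    IsClosed {H : Subgroup G | v ∈ derivedVertices m n H} := by
  have heq : {H : Subgroup G | v ∈ derivedVertices m n H} = {H | T.level v = n} ∩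
      ⋂ w ∈ {w | w ∈ T.subtree v ∧ T.level w = m},
        ⋂ g ∈ (⁅rist G w, rist G w⁆ : Subgroup G), {H | g ∈ H} := by
    ext H
    simp only [derivedVertices, Set.mem_inter_iff, Set.mem_iInter₂, Set.mem_ofPred_eq]
    exact and_congr_right fun _ => ⟨fun h w hw g hg => h w hw.1 hw.2 hg,
      fun h w hw hl g hg => h w ⟨hw, hl⟩ g hg⟩
  rw [heq]
  exact isClosed_const.inter (isClosed_biInter fun w _ => isClosed_biInter fun g _ =>
    (_root_.isClopen_setOf_mem g).isClosed)

theorem smul_mem_derivedVertices {m n : ℕ} (g : G) (H : Subgroup G) {v : V}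
    (hv : v ∈ derivedVertices m n H) : g • v ∈ derivedVertices m n (MulAut.conj g • H) := by
  refine ⟨(level_smul_subgroup g v).trans hv.1, fun w hw hl => ?_⟩
  have h1 : g⁻¹ • w ∈ T.subtree v := by
    have h1 := smul_mem_subtree (g⁻¹ : T.Aut) hw
    change g⁻¹ • w ∈ T.subtree (g⁻¹ • g • v) at h1
    rwa [inv_smul_smul] at h1
  have h2 := hv.2 _ h1 ((level_smul_subgroup g⁻¹ w).trans hl)
  refine Subgroup.commutator_le.2 fun a ha b hb => ?_
  rw [mem_conj_smul]
  have h3 := conj_mem_rist ha g⁻¹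
  have h4 := conj_mem_rist hb g⁻¹
  have h5 := h2 (Subgroup.commutator_mem_commutator h3 h4)
  convert h5 using 1
  simp only [commutatorElement_def]
  group

theorem IsWeaklyBranch.derivedVertices_mono (hG : IsWeaklyBranch G) {m m' n : ℕ} (hn : n ≤ m)
    (hm : m ≤ m') (H : Subgroup G) : derivedVertices m n H ⊆ derivedVertices m' n H := by
  rintro v ⟨hv, h⟩
  refine ⟨hv, fun w hw hl => ?_⟩
  obtain ⟨ξ, hξ⟩ := hG.cylinder_nonempty w
  have hξw : ξ.1 m' = w := hl ▸ hξ
  have h1 := ray_mem_subtree ξ hm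
  rw [hξw] at h1
  have h2 := h (ξ.1 m) (mem_subtree_of_common hw h1 (by rw [ξ.2.1, hv]; exact hn)) (ξ.2.1 m)
  exact (Subgroup.commutator_mono (rist_le_of_mem_subtree h1)
    (rist_le_of_mem_subtree h1)).trans h2

theorem IsWeaklyBranch.disjoint_of_mem_derivedVertices (hG : IsWeaklyBranch G) {m n : ℕ}
    (hn : n ≤ m) {H : Subgroup G} {v : V} (hv : v ∈ derivedVertices m n H) :
    Disjoint (T.cylinder v) (fixedSet H : Set T.Boundary) :=
  Set.disjoint_left.2 fun ξ hξ => hG.notMem_fixedSet (hv.2 (ξ.1 m)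
    ((mem_cylinder_iff_mem_subtree (hv.1.trans_le hn)).1 hξ) (ξ.2.1 m)) (mem_cylinder_ray ξ m)

theorem IsWeaklyBranch.exists_mem_derivedVertices (hG : IsWeaklyBranch G) {𝓗 : Set (Subgroup G)}
    (h𝓗 : IsURS 𝓗) {H : Subgroup G} (hH : H ∈ 𝓗) {v : V}
    (hv : Disjoint (T.cylinder v) (fixedSet H : Set T.Boundary)) :
    ∃ m, T.level v ≤ m ∧ v ∈ derivedVertices m (T.level v) H := by
  obtain ⟨t, ht⟩ := (T.isCompact_cylinder v).elim_finite_subcover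
    (fun w : {w : V // ⁅rist G w, rist G w⁆ ≤ H} => T.cylinder w.1)
    (fun w => T.isOpen_cylinder w.1) (fun ξ hξ => by
      obtain ⟨w, hw, hle⟩ := hG.exists_commutator_rist_le h𝓗 hH (Set.disjoint_left.1 hv hξ)
      exact Set.mem_iUnion.2 ⟨⟨w, hle⟩, hw⟩)
  let m := max (T.level v) (t.sup fun w => T.level w.1)
  refine ⟨m, le_max_left _ _, rfl, fun w hw hl => ?_⟩
  obtain ⟨ξ, hξ⟩ := hG.cylinder_nonempty w
  obtain ⟨z, hz, hξz⟩ := Set.mem_iUnion₂.1 (ht (cylinder_subset_of_mem_subtree hw hξ))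
  have hzm : T.level z.1 ≤ m :=
    (Finset.le_sup (f := fun w : {w : V // ⁅rist G w, rist G w⁆ ≤ H} => T.level w.1) hz).trans
      (le_max_right _ _)
  have h1 := (mem_cylinder_iff_mem_subtree hzm).1 hξz
  have hξw : ξ.1 m = w := hl ▸ hξ
  rw [hξw] at h1
  exact (Subgroup.commutator_mono (rist_le_of_mem_subtree h1)
    (rist_le_of_mem_subtree h1)).trans z.2

/-- The depth at which the derived rigid stabilizers are contained in `H` is uniform in `H ∈ 𝓗`:
the sets `derivedVertices m n H` increase with `m` and their cardinalities are bounded and do not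
depend on `H`. -/
theorem IsWeaklyBranch.exists_uniform_depth (hG : IsWeaklyBranch G) {𝓗 : Set (Subgroup G)}
    (h𝓗 : IsURS 𝓗) (n : ℕ) : ∃ m, n ≤ m ∧ ∀ H ∈ 𝓗, ∀ v, T.level v = n →
      (Disjoint (T.cylinder v) (fixedSet H : Set T.Boundary) ↔ v ∈ derivedVertices m n H) := by
  obtain ⟨H₀, hH₀⟩ := h𝓗.nonempty
  have hΛ := T.finite_level n
  have hsub : ∀ m (H : Subgroup G), derivedVertices m n H ⊆ {v | T.level v = n} :=
    fun m H v hv => hv.1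
  have hcard : ∀ m, ∀ H ∈ 𝓗, (derivedVertices m n H).ncard = (derivedVertices m n H₀).ncard :=
    fun m H hH => h𝓗.ncard_eq hΛ (hsub m) (isClosed_setOf_mem_derivedVertices m n)
      (fun g H v hv => smul_mem_derivedVertices g H hv) hH hH₀
  have hbdd : BddAbove {k | ∃ m ≥ n, (derivedVertices m n H₀).ncard = k} := by
    refine ⟨{v | T.level v = n}.ncard, ?_⟩
    rintro _ ⟨m, -, rfl⟩
    exact Set.ncard_le_ncard (hsub m H₀) hΛ
  have hne : {k | ∃ m ≥ n, (derivedVertices m n H₀).ncard = k}.Nonempty := ⟨_, n, le_rfl, rfl⟩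
  obtain ⟨m, hm, hmax⟩ := Nat.sSup_mem hne hbdd
  refine ⟨m, hm, fun H hH v hv => ⟨fun hdisj => ?_, hG.disjoint_of_mem_derivedVertices hm⟩⟩
  subst hv
  obtain ⟨k, hk, hvk⟩ := hG.exists_mem_derivedVertices h𝓗 hH hdisj
  have h1 : (derivedVertices (max m k) (T.level v) H).ncard ≤
      (derivedVertices m (T.level v) H).ncard := by
    rw [hcard _ H hH, hcard _ H hH, hmax]
    exact le_csSup hbdd ⟨_, hm.trans (le_max_left _ _), rfl⟩
  rw [Set.eq_of_subset_of_ncard_le (hG.derivedVertices_mono hm (le_max_left m k) H) h1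
    (hΛ.subset (hsub _ H))]
  exact hG.derivedVertices_mono hk (le_max_right m k) H hvk

theorem IsWeaklyBranch.isClopen_setOf_disjoint (hG : IsWeaklyBranch G) {𝓗 : Set (Subgroup G)}
    (h𝓗 : IsURS 𝓗) (v : V) :
    IsClopen {H : 𝓗 | Disjoint (T.cylinder v) (fixedSet H.1 : Set T.Boundary)} := by
  obtain ⟨m, -, hm⟩ := hG.exists_uniform_depth h𝓗 (T.level v)
  have heq : {H : 𝓗 | Disjoint (T.cylinder v) (fixedSet H.1 : Set T.Boundary)} =
      {H : 𝓗 | v ∈ derivedVertices m (T.level v) H.1} := by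
    ext H
    exact hm H.1 H.2 v rfl
  rw [heq]
  exact h𝓗.isClopen_setOf_mem (T.finite_level (T.level v)) (fun H v hv => hv.1)
    (isClosed_setOf_mem_derivedVertices m _) (fun g H v hv => smul_mem_derivedVertices g H hv) v

theorem IsWeaklyBranch.continuous_fixedSet (hG : IsWeaklyBranch G) {𝓗 : Set (Subgroup G)}
    (h𝓗 : IsURS 𝓗) : Continuous fun H : 𝓗 => fixedSet (H : Subgroup G) := by
  refine continuous_generateFrom_iff.2 ?_
  rintro _ (⟨K, hK, rfl⟩ | ⟨U, hU, rfl⟩)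
  · refine isOpen_iff_mem_nhds.2 fun H hH => ?_
    have hcov : ∀ ξ ∈ K, ∃ v, ξ ∈ T.cylinder v ∧
        Disjoint (T.cylinder v) (fixedSet H.1 : Set T.Boundary) := by
      intro ξ hξ
      obtain ⟨n, hn⟩ := exists_cylinder_subset (fixedSet H.1).isClosed.isOpen_compl
        (ξ := ξ) (fun h => (Set.eq_empty_iff_forall_notMem.1 hH ξ) ⟨h, hξ⟩)
      exact ⟨ξ.1 n, mem_cylinder_ray ξ n, Set.subset_compl_iff_disjoint_right.1 (hn n le_rfl)⟩
    obtain ⟨t, ht⟩ := hK.elim_finite_subcover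
      (fun v : {v : V // Disjoint (T.cylinder v) (fixedSet H.1 : Set T.Boundary)} =>
        T.cylinder v.1) (fun v => T.isOpen_cylinder v.1) (fun ξ hξ => by
        obtain ⟨v, hv, hd⟩ := hcov ξ hξ
        exact Set.mem_iUnion.2 ⟨⟨v, hd⟩, hv⟩)
    have hnhds : ⋂ v ∈ t, {L : 𝓗 | Disjoint (T.cylinder v.1) (fixedSet L.1 : Set T.Boundary)} ∈
        nhds H := (Filter.biInter_finset_mem t).2 fun v _ =>
      (hG.isClopen_setOf_disjoint h𝓗 v.1).isOpen.mem_nhds v.2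
    filter_upwards [hnhds] with L hL
    refine Set.eq_empty_iff_forall_notMem.2 fun ξ hξ => ?_
    obtain ⟨v, hv, hξv⟩ := Set.mem_iUnion₂.1 (ht hξ.2)
    exact Set.disjoint_left.1 (Set.mem_iInter₂.1 hL v hv) hξv hξ.1
  · refine isOpen_iff_mem_nhds.2 ?_
    rintro H ⟨ξ, hξ, hξU⟩
    obtain ⟨n, hn⟩ := exists_cylinder_subset hU hξU
    filter_upwards [(hG.isClopen_setOf_disjoint h𝓗 (ξ.1 n)).compl.isOpen.mem_nhds
      (fun h => Set.disjoint_left.1 h (mem_cylinder_ray ξ n) hξ)] with L hL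
    obtain ⟨η, hη, hηL⟩ := Set.not_disjoint_iff.1 hL
    exact ⟨η, hηL, hn n le_rfl hη⟩

end FixedPoints

/-! ### Antichains of vertices attached to closed sets -/

section Antichains

/-- A vertex `v` is topmost for `C` if `∂T_v`, but no cylinder of a proper ancestor of `v`, is
disjoint from `C`. -/
def IsTopmost (C : Closeds T.Boundary) (v : V) : Prop :=
  Disjoint (T.cylinder v) (C : Set T.Boundary) ∧
    ∀ u, v ∈ T.subtree u → u ≠ v → ¬ Disjoint (T.cylinder u) (C : Set T.Boundary)

theorem IsTopmost.eq_of_common {C : Closeds T.Boundary} {v w z : V} (hv : IsTopmost C v)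
    (hw : IsTopmost C w) (hzv : z ∈ T.subtree v) (hzw : z ∈ T.subtree w) : v = w := by
  by_contra hne
  rcases le_total (T.level v) (T.level w) with h | h
  · exact hw.2 v (mem_subtree_of_common hzv hzw h) hne hv.1
  · exact hv.2 w (mem_subtree_of_common hzw hzv h) (Ne.symm hne) hw.1

/-- The antichain of the descendants of level `m n` of the topmost vertices for `C` of level `n`,
where `n` ranges over all levels. -/
def topAntichain (m : ℕ → ℕ) (C : Closeds T.Boundary) : T.Antichain :=
  ⟨{w | ∃ v, IsTopmost C v ∧ w ∈ T.subtree v ∧ T.level w = m (T.level v)}, by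
    rintro w ⟨v, hv, hwv, hw⟩ w' ⟨v', hv', hwv', hw'⟩ hne
    refine Set.disjoint_left.2 fun z hz hz' => hne ?_
    have h1 := hv.eq_of_common hv' (mem_subtree_trans hwv hz) (mem_subtree_trans hwv' hz')
    have h2 : T.level w = T.level w' := by rw [hw, hw', h1]
    exact eq_of_mem_subtree_of_level_eq (mem_subtree_of_common hz hz' h2.le) h2⟩

theorem isClopen_setOf_disjoint_cylinder (v : V) :
    IsClopen {C : Closeds T.Boundary | Disjoint (T.cylinder v) (C : Set T.Boundary)} := by
  constructor
  · refine ⟨TopologicalSpace.isOpen_generateFrom_of_mem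
      (Or.inr ⟨T.cylinder v, T.isOpen_cylinder v, ?_⟩)⟩
    ext C
    rw [Set.mem_compl_iff, Set.mem_ofPred_eq, Set.not_disjoint_iff_nonempty_inter, Set.inter_comm]
    rfl
  · refine TopologicalSpace.isOpen_generateFrom_of_mem
      (Or.inl ⟨T.cylinder v, T.isCompact_cylinder v, ?_⟩)
    ext C
    rw [Set.mem_ofPred_eq, Set.disjoint_iff_inter_eq_empty, Set.inter_comm]
    rfl

theorem isClopen_setOf_isTopmost (v : V) : IsClopen {C : Closeds T.Boundary | IsTopmost C v} := by
  have heq : {C : Closeds T.Boundary | IsTopmost C v} =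
      {C : Closeds T.Boundary | Disjoint (T.cylinder v) (C : Set T.Boundary)} ∩
        ⋂ u ∈ {u | v ∈ T.subtree u ∧ u ≠ v},
        {C : Closeds T.Boundary | Disjoint (T.cylinder u) (C : Set T.Boundary)}ᶜ := by
    ext C
    simp only [IsTopmost, Set.mem_inter_iff, Set.mem_iInter₂, Set.mem_ofPred_eq, Set.mem_compl_iff,
      and_imp]
  rw [heq]
  exact (isClopen_setOf_disjoint_cylinder v).inter (Set.Finite.isClopen_biInter
    ((finite_ancestors v).subset fun u hu => hu.1)
      fun u _ => (isClopen_setOf_disjoint_cylinder u).compl)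

theorem continuous_topAntichain (m : ℕ → ℕ) :
    Continuous (topAntichain m : Closeds T.Boundary → T.Antichain) := by
  classical
  refine continuous_induced_rng.2 (continuous_pi fun w => (continuous_bool_rng true).2 ?_)
  have h1 : IsClopen (⋃ v ∈ {v | w ∈ T.subtree v ∧ T.level w = m (T.level v)},
      {C : Closeds T.Boundary | IsTopmost C v}) :=
    Set.Finite.isClopen_biUnion ((finite_ancestors w).subset fun v hv => hv.1)
      fun v _ => isClopen_setOf_isTopmost v
  convert h1 using 1
  ext C
  simp only [Set.mem_preimage, Function.comp_apply, Set.mem_singleton_iff, decide_eq_true_eq,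
    Set.mem_iUnion₂, Set.mem_ofPred_eq, exists_prop]
  exact exists_congr fun v => and_comm

theorem IsTopmost.smul {C : Closeds T.Boundary} {v : V} (hv : IsTopmost C v) (g : G) :
    IsTopmost (g • C) (g • v) := by
  have hdisj : ∀ u, Disjoint (T.cylinder (g • u)) ((g • C : Closeds T.Boundary) : Set T.Boundary) ↔
      Disjoint (T.cylinder u) (C : Set T.Boundary) := by
    intro u
    rw [← smul_cylinder_subgroup]
    exact Set.disjoint_smul_set
  refine ⟨(hdisj v).2 hv.1, fun u hu hne hd => ?_⟩
  have h1 : v ∈ T.subtree (g⁻¹ • u) := by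
    have h1 := smul_mem_subtree (g⁻¹ : T.Aut) hu
    change g⁻¹ • g • v ∈ T.subtree (g⁻¹ • u) at h1
    rwa [inv_smul_smul] at h1
  refine hv.2 _ h1 (fun h => hne (inv_smul_eq_iff.1 h)) ((hdisj _).1 ?_)
  rwa [smul_inv_smul]

theorem smul_mem_topAntichain (m : ℕ → ℕ) (g : G) {C : Closeds T.Boundary} {w : V}
    (hw : w ∈ (topAntichain m C).1) : g • w ∈ (topAntichain m (g • C)).1 := by
  obtain ⟨v, hv, hwv, hl⟩ := hw
  exact ⟨g • v, hv.smul g, smul_mem_subtree (g : T.Aut) hwv, by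
    rw [level_smul_subgroup, level_smul_subgroup, hl]⟩

theorem topAntichain_smul (m : ℕ → ℕ) (g : G) (C : Closeds T.Boundary) :
    topAntichain m (g • C) = g • topAntichain m C := by
  refine Subtype.ext (Set.ext fun w => ⟨fun hw => ?_, ?_⟩)
  · have h1 := smul_mem_topAntichain m g⁻¹ hw
    rw [inv_smul_smul] at h1
    exact ⟨_, h1, smul_inv_smul g w⟩
  · rintro ⟨z, hz, rfl⟩
    exact smul_mem_topAntichain m g hz

theorem piPerp_topAntichain {m : ℕ → ℕ} (hm : ∀ n, n ≤ m n) (C : Closeds T.Boundary) :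
    T.piPerp (topAntichain m C) = C := by
  refine Closeds.ext (Set.ext fun ξ => ?_)
  change ξ ∉ ⋃ w ∈ (topAntichain m C).1, T.cylinder w ↔ ξ ∈ (C : Set T.Boundary)
  rw [not_iff_comm]
  constructor
  · intro hξ
    classical
    have hex : ∃ n, Disjoint (T.cylinder (ξ.1 n)) (C : Set T.Boundary) := by
      obtain ⟨n, hn⟩ := exists_cylinder_subset C.isClosed.isOpen_compl hξ
      exact ⟨n, Set.subset_compl_iff_disjoint_right.1 (hn n le_rfl)⟩
    have htop : IsTopmost C (ξ.1 (Nat.find hex)) := by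
      refine ⟨Nat.find_spec hex, fun u hu hne hd => ?_⟩
      have hul := level_le_of_mem_subtree hu
      rw [ξ.2.1] at hul
      have hξu : ξ.1 (T.level u) = u := (mem_cylinder_iff_mem_subtree hul).2 hu
      rw [← hξu] at hd
      refine hne ?_
      rw [← hξu, le_antisymm hul (Nat.find_min' hex hd)]
    refine Set.mem_iUnion₂.2 ⟨ξ.1 (m (Nat.find hex)), ⟨_, htop, ray_mem_subtree ξ (hm _), ?_⟩,
      mem_cylinder_ray ξ _⟩
    rw [ξ.2.1, ξ.2.1]
  · intro hξ hC
    obtain ⟨w, ⟨v, hv, hwv, -⟩, hξw⟩ := Set.mem_iUnion₂.1 hξ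
    exact Set.disjoint_left.1 hv.1 (cylinder_subset_of_mem_subtree hwv hξw) hC

theorem fixedSet_conj (g : G) (H : Subgroup G) : fixedSet (MulAut.conj g • H) = g • fixedSet H := by
  refine Closeds.ext (Set.ext fun ξ => ?_)
  change (∀ h ∈ MulAut.conj g • H, h • ξ = ξ) ↔ ξ ∈ g • {η : T.Boundary | ∀ h ∈ H, h • η = η}
  rw [Set.mem_smul_set_iff_inv_smul_mem]
  constructor
  · intro hξ h hh
    have h1 := hξ (g * h * g⁻¹) (mem_conj_smul.2 (by convert hh using 1; group))
    rw [mul_smul, mul_smul, smul_eq_iff_eq_inv_smul] at h1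
    exact h1
  · intro hξ h hh
    have h1 := hξ _ (mem_conj_smul.1 hh)
    rw [mul_smul, smul_inv_smul, mul_smul, smul_left_cancel_iff] at h1
    exact h1

end Antichains

end LFRootedTree

theorem mainTheorem4 {V : Type u} (T : LFRootedTree V) (G : Subgroup T.Aut)
    (hG : LFRootedTree.IsWeaklyBranch G) (𝓗 : Set (Subgroup G)) (h𝓗 : IsURS 𝓗) :
    Continuous (fun H : 𝓗 => LFRootedTree.fixedSet (H : Subgroup G)) ∧
    ∃ σ : LFRootedTree.fixedSets 𝓗 → T.Antichain,
      Continuous σ ∧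
      (∀ (g : G) (C : LFRootedTree.fixedSets 𝓗),
        ∃ hgC : g • (C : Closeds T.Boundary) ∈ LFRootedTree.fixedSets 𝓗,
          σ ⟨g • (C : Closeds T.Boundary), hgC⟩ = g • σ C) ∧
      (∀ C : LFRootedTree.fixedSets 𝓗, T.piPerp (σ C) = C) ∧
      (∀ (H : Subgroup G) (hH : H ∈ 𝓗),
        ∀ v ∈ (σ ⟨LFRootedTree.fixedSet H, Set.mem_image_of_mem _ hH⟩).1,
          ⁅LFRootedTree.rist G v, LFRootedTree.rist G v⁆ ≤ H) := by
  -- `m n` is a level at which the derived rigid stabilizers below a vertex of level `n` that avoids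
  -- `Fix(H)` are contained in `H`, for all `H ∈ 𝓗` at once.
  choose m hm hdepth using hG.exists_uniform_depth h𝓗
  refine ⟨hG.continuous_fixedSet h𝓗, fun C => LFRootedTree.topAntichain m C.1,
    (LFRootedTree.continuous_topAntichain m).comp continuous_subtype_val, ?_,
    fun C => LFRootedTree.piPerp_topAntichain hm C.1, ?_⟩
  · rintro g ⟨_, H, hH, rfl⟩
    exact ⟨⟨MulAut.conj g • H, h𝓗.invariant g H hH, LFRootedTree.fixedSet_conj g H⟩,
      LFRootedTree.topAntichain_smul m g _⟩
  · rintro H hH w ⟨v, hv, hwv, hl⟩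
    exact ((hdepth _ H hH v rfl).1 hv.1).2 w hwv hl
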